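/- **Theorem (Conservativity of DHoTT over HoTT).** Let $\mathbb T$ be a small poset (of times), let $\mathsf{ET}$ be an evolving text over $\mathbb T$, let $\tau\in\mathbb T$, and let $J$ be a closed judgement of HoTT (a judgement in the empty context, of one of the forms $\Gamma\ \mathrm{ctx}$, $\Gamma\vdash A\ \mathrm{type}$, $\Gamma\vdash t:A$, $\Gamma\vdash t\equiv s:A$, written in the syntax of HoTT). Then $$\mathrm{HoTT}\vdash J\quad\Longleftrightarrow\quad \mathrm{DHoTT}\vdash_\tau J .$$ Here HoTT on the left has no times at all, and on the right $J$ is read in the syntax of DHoTT at the fixed time $\tau$. *HoTT* is intensional Martin-Löf type theory with a cumulative hierarchy of Russell universes $\mathcal U_0,\mathcal U_1,\dots$, $\Pi$- and $\Sigma$-types and a unit type (with $\beta$ and $\eta$), the empty type, coproducts, natural numbers, lists, identity types with path induction, function extensionality, univalence for every universe, and the higher inductive types circle, homotopy pushout and propositional truncation (judgemental computation on points, propositional computation on paths). An *evolving text* consists of a presheaf $\mathsf{ET}:\mathbb T^{\mathrm{op}}\to\mathbf{sSet}$ of Kan complexes, with restrictions $r_{\tau,\tau'}:\mathsf{ET}(\tau')\to\mathsf{ET}(\tau)$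 for $\tau\le\tau'$; for each $\tau$ a finite set $K_\tau$ of caps with a membership predicate on the vertices of $\mathsf{ET}(\tau)$ and a linking relation on $K_\tau$; a hop bound $H_\tau$; a decidable policy $\mathsf{Adm}$ on finite chains of caps; for each chain a set of open-horn tags; and a family of measured predicates on tuples of vertices, with specified sets of elements. An *attempt* from a vertex $x$ to a vertex $y$ is a chain of between $1$ and $H_\tau+1$ caps, consecutive ones linked, whose first cap contains $x$ and whose last contains $y$. *DHoTT* over $\mathsf{ET}$ has judgements $\vdash_\sigma$ anchored at times $\sigma\in\mathbb T$. All rules of HoTT hold at every anchor, and there are in addition: - types $\mathsf{ET}(\tau):\mathcal U_0$ and functions $r_{\tau,\tau'}$ with $r_{\tau,\tau}(a)\equiv a$ and $r_{\tau,\tau''}(a)\equiv r_{\tau,\tau'}(r_{\tau',\tau''}(a))$; points, paths and 2-cells of $\mathsf{ET}(\tau)$ for the vertices, edges and triangles of the slice, with degenerate edges equal to $\mathsf{refl}$ and restriction computing on the given points and paths; - for $C:\mathsf{ET}(\tau)\to\mathcal U_i$, $p:\mathsf{Id}_{\mathsf{ET}(\tau)}(x,y)$ and $u:C(x)$, a term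 $\mathsf{transport}_C(p,u):C(y)$, judgementally trivial if $p$ is $\mathsf{refl}$ or $C$ is constant, and judgementally compatible with concatenation of paths; - $\mathsf{Carry}^{\tau\to\tau'}(a):=\Sigma(a':\mathsf{ET}(\tau')).\,\mathsf{Id}_{\mathsf{ET}(\tau)}(r_{\tau,\tau'}(a'),a)$ for $\tau\le\tau'$ and $a:\mathsf{ET}(\tau)$. Formation is at $\tau$. Introduction forms $\langle a',\rho\rangle$ at $\tau$ from $a'$ at $\tau'$ and $\rho$ at $\tau$. Use: from $t:C(a)$ and a carry with components $a',\rho$ at $\tau$ one gets $\mathsf{transport}_C(\rho^{-1},t):C(r_{\tau,\tau'}(a'))$ at $\tau'$; the same for dependent sections of a family over $\mathsf{ET}(\tau)$ evaluated at $a$. Carries $\langle a_1,\rho_1\rangle$ of $a_0$ and $\langle a_2,\rho_2\rangle$ of $a_1$ compose to the carry of $a_0$ with echo $a_2$ and path $r_{\tau_0,\tau_1}(\rho_2)$ followed by $\rho_1$, and transport along the composite is judgementally the successive transport; - types $\mathsf{PathAttempt}(a,b)$ for $a,b:\mathsf{ET}(\tau)$, and $\mathsf{Adm}(p)$, $\mathsf{OpenHorn}(p)$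 for $p:\mathsf{PathAttempt}(a,b)$, all in $\mathcal U_0$, with an element of $\mathsf{PathAttempt}(x,y)$ for every attempt between vertices, an element of $\mathsf{Adm}$ or of $\neg\mathsf{Adm}$ for it as decided by the policy, and elements of $\mathsf{OpenHorn}$ for its tags; the type $$\mathsf{Rupture}(\tau\to\tau';a):=\Sigma(a':\mathsf{ET}(\tau')).\,\Sigma(p:\mathsf{PathAttempt}(a,r_{\tau,\tau'}(a'))).\,\neg\mathsf{Adm}(p)\times\mathsf{OpenHorn}(p);$$ - types $\sum_{\tau'\ge\tau}\mathsf{Rupture}(\tau\to\tau';a)$ and $\sum_{\tau'\ge\tau}\mathsf{Carry}^{\tau\to\tau'}(a)$ in $\mathcal U_0$ with their injections, and the ledger, the type of lists in their coproduct; - types in $\mathcal U_0$ over points of $\mathsf{ET}(\tau)$ for the measured predicates, with their measured elements. -/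

import Mathlib

open CategoryTheory

universe u v

namespace DynHoTT

/-! ## Raw syntax

Well-scoped de Bruijn syntax: `Tm S n` is the type of raw expressions in `n` free variables,
variable `0` being the most recent one.  Types and terms form one syntactic class (universes are
à la Russell).  The core formers are those of HoTT.  `S` is a family of additional non-binding
operation symbols: HoTT has none, DHoTT has those of `DynOp` below. -/

/-- A family of operation symbols with arities. -/
structure Ops where
  Op : Type u
  ar : Op → ℕ

/-- Raw expressions.  An argument of type `Tm S (n + k)` is bound in `k` variables. -/
inductive Tm (S : Ops.{u}) : ℕ → Type u
  | var {n : ℕ} (i : Fin n) : Tm S n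
  | op {n : ℕ} (f : S.Op) (args : Fin (S.ar f) → Tm S n) : Tm S n
  -- universes
  | U {n : ℕ} (i : ℕ) : Tm S n
  -- dependent functions
  | pi {n : ℕ} (A : Tm S n) (B : Tm S (n + 1)) : Tm S n
  | lam {n : ℕ} (A : Tm S n) (b : Tm S (n + 1)) : Tm S n
  | app {n : ℕ} (f a : Tm S n) : Tm S n
  -- dependent pairs
  | sigma {n : ℕ} (A : Tm S n) (B : Tm S (n + 1)) : Tm S n
  | pair {n : ℕ} (a b : Tm S n) : Tm S n
  | fst {n : ℕ} (p : Tm S n) : Tm S n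
  | snd {n : ℕ} (p : Tm S n) : Tm S n
  -- empty type and unit type
  | empty {n : ℕ} : Tm S n
  | emptyInd {n : ℕ} (C : Tm S (n + 1)) (e : Tm S n) : Tm S n
  | unit {n : ℕ} : Tm S n
  | star {n : ℕ} : Tm S n
  -- coproducts
  | sum {n : ℕ} (A B : Tm S n) : Tm S n
  | inl {n : ℕ} (a : Tm S n) : Tm S n
  | inr {n : ℕ} (b : Tm S n) : Tm S n
  | sumInd {n : ℕ} (C c d : Tm S (n + 1)) (e : Tm S n) : Tm S n
  -- natural numbers
  | nat {n : ℕ} : Tm S n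
  | zero {n : ℕ} : Tm S n
  | succ {n : ℕ} (k : Tm S n) : Tm S n
  | natInd {n : ℕ} (C : Tm S (n + 1)) (z : Tm S n) (s : Tm S (n + 2)) (k : Tm S n) : Tm S n
  -- lists
  | list {n : ℕ} (A : Tm S n) : Tm S n
  | nil {n : ℕ} : Tm S n
  | cons {n : ℕ} (a l : Tm S n) : Tm S n
  | listInd {n : ℕ} (C : Tm S (n + 1)) (z : Tm S n) (s : Tm S (n + 3)) (l : Tm S n) : Tm S n
  -- identity types, with based path induction
  | id {n : ℕ} (A a b : Tm S n) : Tm S n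
  | refl {n : ℕ} (a : Tm S n) : Tm S n
  | J {n : ℕ} (C : Tm S (n + 2)) (c b p : Tm S n) : Tm S n
  -- function extensionality and univalence
  | funext {n : ℕ} (A : Tm S n) (B : Tm S (n + 1)) (f g : Tm S n) : Tm S n
  | ua {n : ℕ} (i : ℕ) (A B : Tm S n) : Tm S n
  -- the circle
  | circle {n : ℕ} : Tm S n
  | base {n : ℕ} : Tm S n
  | loop {n : ℕ} : Tm S n
  | circleInd {n : ℕ} (C : Tm S (n + 1)) (b l x : Tm S n) : Tm S n
  | circleLoop {n : ℕ} (C : Tm S (n + 1)) (b l : Tm S n) : Tm S n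
  -- the homotopy pushout of `f : D → A` and `g : D → B`
  | push {n : ℕ} (A B D f g : Tm S n) : Tm S n
  | pinl {n : ℕ} (a : Tm S n) : Tm S n
  | pinr {n : ℕ} (b : Tm S n) : Tm S n
  | pglue {n : ℕ} (c : Tm S n) : Tm S n
  | pushInd {n : ℕ} (C l r k : Tm S (n + 1)) (x : Tm S n) : Tm S n
  | pushGlue {n : ℕ} (C l r k : Tm S (n + 1)) (c : Tm S n) : Tm S n
  -- propositional truncation
  | trunc {n : ℕ} (A : Tm S n) : Tm S n
  | tin {n : ℕ} (a : Tm S n) : Tm S n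
  | tpath {n : ℕ} (x y : Tm S n) : Tm S n
  | truncInd {n : ℕ} (C t : Tm S (n + 1)) (s : Tm S (n + 4)) (x : Tm S n) : Tm S n

variable {S : Ops.{u}}

/-- Extend a renaming under a binder. -/
def liftR {n m : ℕ} (ρ : Fin n → Fin m) : Fin (n + 1) → Fin (m + 1) :=
  Fin.cases 0 (fun i => (ρ i).succ)

namespace Tm

/-- Renaming of variables. -/
def rename : {n m : ℕ} → (Fin n → Fin m) → Tm S n → Tm S m
  | _, _, ρ, var i => var (ρ i)
  | _, _, ρ, op f args => op f (fun i => (args i).rename ρ)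
  | _, _, _, U i => U i
  | _, _, ρ, pi A B => pi (A.rename ρ) (B.rename (liftR ρ))
  | _, _, ρ, lam A b => lam (A.rename ρ) (b.rename (liftR ρ))
  | _, _, ρ, app f a => app (f.rename ρ) (a.rename ρ)
  | _, _, ρ, sigma A B => sigma (A.rename ρ) (B.rename (liftR ρ))
  | _, _, ρ, pair a b => pair (a.rename ρ) (b.rename ρ)
  | _, _, ρ, fst p => fst (p.rename ρ)
  | _, _, ρ, snd p => snd (p.rename ρ)
  | _, _, _, empty => empty
  | _, _, ρ, emptyInd C e => emptyInd (C.rename (liftR ρ)) (e.rename ρ)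
  | _, _, _, unit => unit
  | _, _, _, star => star
  | _, _, ρ, sum A B => sum (A.rename ρ) (B.rename ρ)
  | _, _, ρ, inl a => inl (a.rename ρ)
  | _, _, ρ, inr b => inr (b.rename ρ)
  | _, _, ρ, sumInd C c d e =>
      sumInd (C.rename (liftR ρ)) (c.rename (liftR ρ)) (d.rename (liftR ρ)) (e.rename ρ)
  | _, _, _, nat => nat
  | _, _, _, zero => zero
  | _, _, ρ, succ k => succ (k.rename ρ)
  | _, _, ρ, natInd C z s k =>
      natInd (C.rename (liftR ρ)) (z.rename ρ) (s.rename (liftR (liftR ρ))) (k.rename ρ)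
  | _, _, ρ, list A => list (A.rename ρ)
  | _, _, _, nil => nil
  | _, _, ρ, cons a l => cons (a.rename ρ) (l.rename ρ)
  | _, _, ρ, listInd C z s l =>
      listInd (C.rename (liftR ρ)) (z.rename ρ) (s.rename (liftR (liftR (liftR ρ))))
        (l.rename ρ)
  | _, _, ρ, id A a b => id (A.rename ρ) (a.rename ρ) (b.rename ρ)
  | _, _, ρ, refl a => refl (a.rename ρ)
  | _, _, ρ, J C c b p =>
      J (C.rename (liftR (liftR ρ))) (c.rename ρ) (b.rename ρ) (p.rename ρ)
  | _, _, ρ, funext A B f g =>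
      funext (A.rename ρ) (B.rename (liftR ρ)) (f.rename ρ) (g.rename ρ)
  | _, _, ρ, ua i A B => ua i (A.rename ρ) (B.rename ρ)
  | _, _, _, circle => circle
  | _, _, _, base => base
  | _, _, _, loop => loop
  | _, _, ρ, circleInd C b l x =>
      circleInd (C.rename (liftR ρ)) (b.rename ρ) (l.rename ρ) (x.rename ρ)
  | _, _, ρ, circleLoop C b l => circleLoop (C.rename (liftR ρ)) (b.rename ρ) (l.rename ρ)
  | _, _, ρ, push A B D f g =>
      push (A.rename ρ) (B.rename ρ) (D.rename ρ) (f.rename ρ) (g.rename ρ)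
  | _, _, ρ, pinl a => pinl (a.rename ρ)
  | _, _, ρ, pinr b => pinr (b.rename ρ)
  | _, _, ρ, pglue c => pglue (c.rename ρ)
  | _, _, ρ, pushInd C l r k x =>
      pushInd (C.rename (liftR ρ)) (l.rename (liftR ρ)) (r.rename (liftR ρ))
        (k.rename (liftR ρ)) (x.rename ρ)
  | _, _, ρ, pushGlue C l r k c =>
      pushGlue (C.rename (liftR ρ)) (l.rename (liftR ρ)) (r.rename (liftR ρ))
        (k.rename (liftR ρ)) (c.rename ρ)
  | _, _, ρ, trunc A => trunc (A.rename ρ)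
  | _, _, ρ, tin a => tin (a.rename ρ)
  | _, _, ρ, tpath x y => tpath (x.rename ρ) (y.rename ρ)
  | _, _, ρ, truncInd C t s x =>
      truncInd (C.rename (liftR ρ)) (t.rename (liftR ρ))
        (s.rename (liftR (liftR (liftR (liftR ρ))))) (x.rename ρ)

/-- Weakening by one variable. -/
def wk {n : ℕ} (t : Tm S n) : Tm S (n + 1) := t.rename Fin.succ

/-- Weakening by one variable that is inserted just below the most recent one. -/
def wkU {n : ℕ} (t : Tm S (n + 1)) : Tm S (n + 2) := t.rename (liftR Fin.succ)

end Tm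

/-- Extend a substitution under a binder. -/
def liftS {n m : ℕ} (σ : Fin n → Tm S m) : Fin (n + 1) → Tm S (m + 1) :=
  Fin.cases (Tm.var 0) (fun i => (σ i).wk)

namespace Tm

/-- Simultaneous capture-avoiding substitution. -/
def subst : {n m : ℕ} → (Fin n → Tm S m) → Tm S n → Tm S m
  | _, _, σ, var i => σ i
  | _, _, σ, op f args => op f (fun i => (args i).subst σ)
  | _, _, _, U i => U i
  | _, _, σ, pi A B => pi (A.subst σ) (B.subst (liftS σ))
  | _, _, σ, lam A b => lam (A.subst σ) (b.subst (liftS σ))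
  | _, _, σ, app f a => app (f.subst σ) (a.subst σ)
  | _, _, σ, sigma A B => sigma (A.subst σ) (B.subst (liftS σ))
  | _, _, σ, pair a b => pair (a.subst σ) (b.subst σ)
  | _, _, σ, fst p => fst (p.subst σ)
  | _, _, σ, snd p => snd (p.subst σ)
  | _, _, _, empty => empty
  | _, _, σ, emptyInd C e => emptyInd (C.subst (liftS σ)) (e.subst σ)
  | _, _, _, unit => unit
  | _, _, _, star => star
  | _, _, σ, sum A B => sum (A.subst σ) (B.subst σ)
  | _, _, σ, inl a => inl (a.subst σ)
  | _, _, σ, inr b => inr (b.subst σ)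
  | _, _, σ, sumInd C c d e =>
      sumInd (C.subst (liftS σ)) (c.subst (liftS σ)) (d.subst (liftS σ)) (e.subst σ)
  | _, _, _, nat => nat
  | _, _, _, zero => zero
  | _, _, σ, succ k => succ (k.subst σ)
  | _, _, σ, natInd C z s k =>
      natInd (C.subst (liftS σ)) (z.subst σ) (s.subst (liftS (liftS σ))) (k.subst σ)
  | _, _, σ, list A => list (A.subst σ)
  | _, _, _, nil => nil
  | _, _, σ, cons a l => cons (a.subst σ) (l.subst σ)
  | _, _, σ, listInd C z s l =>
      listInd (C.subst (liftS σ)) (z.subst σ) (s.subst (liftS (liftS (liftS σ)))) (l.subst σ)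
  | _, _, σ, id A a b => id (A.subst σ) (a.subst σ) (b.subst σ)
  | _, _, σ, refl a => refl (a.subst σ)
  | _, _, σ, J C c b p => J (C.subst (liftS (liftS σ))) (c.subst σ) (b.subst σ) (p.subst σ)
  | _, _, σ, funext A B f g =>
      funext (A.subst σ) (B.subst (liftS σ)) (f.subst σ) (g.subst σ)
  | _, _, σ, ua i A B => ua i (A.subst σ) (B.subst σ)
  | _, _, _, circle => circle
  | _, _, _, base => base
  | _, _, _, loop => loop
  | _, _, σ, circleInd C b l x =>
      circleInd (C.subst (liftS σ)) (b.subst σ) (l.subst σ) (x.subst σ)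
  | _, _, σ, circleLoop C b l => circleLoop (C.subst (liftS σ)) (b.subst σ) (l.subst σ)
  | _, _, σ, push A B D f g =>
      push (A.subst σ) (B.subst σ) (D.subst σ) (f.subst σ) (g.subst σ)
  | _, _, σ, pinl a => pinl (a.subst σ)
  | _, _, σ, pinr b => pinr (b.subst σ)
  | _, _, σ, pglue c => pglue (c.subst σ)
  | _, _, σ, pushInd C l r k x =>
      pushInd (C.subst (liftS σ)) (l.subst (liftS σ)) (r.subst (liftS σ))
        (k.subst (liftS σ)) (x.subst σ)
  | _, _, σ, pushGlue C l r k c =>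
      pushGlue (C.subst (liftS σ)) (l.subst (liftS σ)) (r.subst (liftS σ))
        (k.subst (liftS σ)) (c.subst σ)
  | _, _, σ, trunc A => trunc (A.subst σ)
  | _, _, σ, tin a => tin (a.subst σ)
  | _, _, σ, tpath x y => tpath (x.subst σ) (y.subst σ)
  | _, _, σ, truncInd C t s x =>
      truncInd (C.subst (liftS σ)) (t.subst (liftS σ))
        (s.subst (liftS (liftS (liftS (liftS σ))))) (x.subst σ)

variable {n : ℕ}

/-- `C[a]`: substitute `a` for the most recent variable. -/
def inst (C : Tm S (n + 1)) (a : Tm S n) : Tm S n := C.subst (Fin.cases a var)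

/-- `C[a, b]`: substitute `b` for the most recent variable and `a` for the one before. -/
def inst₂ (C : Tm S (n + 2)) (a b : Tm S n) : Tm S n :=
  C.subst (Fin.cases b (Fin.cases a var))

/-- `C[a, b, c]`: substitute `c` for the most recent variable, `b` and `a` for those before. -/
def inst₃ (C : Tm S (n + 3)) (a b c : Tm S n) : Tm S n :=
  C.subst (Fin.cases c (Fin.cases b (Fin.cases a var)))

/-- `C[a]` in a context with one more variable, on which `a` may depend. -/
def at₁ (C : Tm S (n + 1)) (a : Tm S (n + 1)) : Tm S (n + 1) := C.wkU.inst a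

/-- `C[a]` in a context with two more variables. -/
def at₂ (C : Tm S (n + 1)) (a : Tm S (n + 2)) : Tm S (n + 2) := C.wkU.wkU.inst a

/-- `C[a]` in a context with three more variables. -/
def at₃ (C : Tm S (n + 1)) (a : Tm S (n + 3)) : Tm S (n + 3) := C.wkU.wkU.wkU.inst a

/-- `C[a]` in a context with four more variables. -/
def at₄ (C : Tm S (n + 1)) (a : Tm S (n + 4)) : Tm S (n + 4) := C.wkU.wkU.wkU.wkU.inst a

/-! ### Derived notions of HoTT -/

def arrow (A B : Tm S n) : Tm S n := pi A B.wk

def prod (A B : Tm S n) : Tm S n := sigma A B.wk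

/-- Transport of `t : C[a]` along `p : a = b` in the family `x : A ⊢ C`; its type is `C[b]`. -/
def transport (C : Tm S (n + 1)) (b p t : Tm S n) : Tm S n := J C.wk t b p

/-- The inverse `b = a` of a path `p : a = b` in `A`. -/
def inv (A a b p : Tm S n) : Tm S n :=
  J (id A.wk.wk (var 1) a.wk.wk) (refl a) b p

/-- The concatenation `a = c` of `p : a = b` and `q : b = c` in `A`. -/
def concat (A a c p q : Tm S n) : Tm S n :=
  J (id A.wk.wk a.wk.wk (var 1)) p c q

/-- The path `f[a] = f[b]` in `B` induced by `p : a = b` and `x : A ⊢ f : B`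
(`B` does not depend on `x`). -/
def ap (B : Tm S n) (f : Tm S (n + 1)) (a b p : Tm S n) : Tm S n :=
  J (id B.wk.wk (f.inst a).wk.wk f.wk) (refl (f.inst a)) b p

/-- The path `transport C p f[a] = f[b]` induced by `p : a = b` and `x : A ⊢ f : C`. -/
def apd (C f : Tm S (n + 1)) (a b p : Tm S n) : Tm S n :=
  J (id C.wk (transport C.wkU.wkU (var 1) (var 0) (f.inst a).wk.wk) f.wk) (refl (f.inst a)) b p

/-- `f : A → B` has a right inverse and a left inverse. -/
def isEquiv (A B f : Tm S n) : Tm S n :=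
  prod
    (sigma (arrow B A)
      (pi B.wk (id B.wk.wk (app f.wk.wk (app (var 1) (var 0))) (var 0))))
    (sigma (arrow B A)
      (pi A.wk (id A.wk.wk (app (var 1) (app f.wk.wk (var 0))) (var 0))))

/-- The type of equivalences from `A` to `B`. -/
def equiv (A B : Tm S n) : Tm S n := sigma (arrow A B) (isEquiv A.wk B.wk (var 0))

/-- The identity equivalence of `A`. -/
def idEquiv (A : Tm S n) : Tm S n :=
  pair (lam A (var 0))
    (pair (pair (lam A (var 0)) (lam A (refl (var 0))))
      (pair (lam A (var 0)) (lam A (refl (var 0)))))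

/-- The canonical map from `A = B` in the universe `U i` to equivalences from `A` to `B`. -/
def idToEquiv (i : ℕ) (A B : Tm S n) : Tm S n :=
  lam (id (U i) A B) (J (equiv A.wk.wk.wk (var 1)) (idEquiv A.wk) B.wk (var 0))

/-- The type of homotopies between `f` and `g`, both of type `pi A B`. -/
def homotopy (A : Tm S n) (B : Tm S (n + 1)) (f g : Tm S n) : Tm S n :=
  pi A (id B (app f.wk (var 0)) (app g.wk (var 0)))

/-- The canonical map from `f = g` to homotopies between `f` and `g`. -/
def happly (A : Tm S n) (B : Tm S (n + 1)) (f g : Tm S n) : Tm S n :=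
  lam (id (pi A B) f g)
    (J (homotopy A.wk.wk.wk B.wkU.wkU.wkU f.wk.wk.wk (var 1))
      (lam A.wk (refl (app f.wk.wk (var 0)))) g.wk (var 0))

end Tm

/-! ## Contexts and judgements -/

/-- Telescopes. -/
inductive Ctx (S : Ops.{u}) : ℕ → Type u
  | nil : Ctx S 0
  | snoc {n : ℕ} (Γ : Ctx S n) (A : Tm S n) : Ctx S (n + 1)

/-- The type of a variable, weakened to the whole context. -/
def Ctx.get : {n : ℕ} → Ctx S n → Fin n → Tm S n
  | _, .snoc Γ A, i => Fin.cases A.wk (fun j => (Γ.get j).wk) i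

/-- The judgement forms `Γ ctx`, `Γ ⊢ A type`, `Γ ⊢ t : A` and `Γ ⊢ t ≡ s : A`.  Judgemental
equality of types is judgemental equality in a universe. -/
inductive Judg (S : Ops.{u}) : Type u
  | ctx {n : ℕ} (Γ : Ctx S n) : Judg S
  | ty {n : ℕ} (Γ : Ctx S n) (A : Tm S n) : Judg S
  | tm {n : ℕ} (Γ : Ctx S n) (t A : Tm S n) : Judg S
  | eq {n : ℕ} (Γ : Ctx S n) (t s A : Tm S n) : Judg S

/-- The number of hypotheses of a judgement. -/
def Judg.dim : Judg S → ℕ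
  | .ctx (n := n) _ => n
  | .ty (n := n) _ _ => n
  | .tm (n := n) _ _ _ => n
  | .eq (n := n) _ _ _ _ => n

/-- A judgement is closed if its context is empty. -/
def Judg.IsClosed (J : Judg S) : Prop := J.dim = 0

/-! ## Derivations

`Der R a J`: the judgement `J` is derivable at the anchor `a` from the rules of HoTT, which are
available at every anchor, and the further rules `R`, whose premises and conclusion may carry
different anchors.  HoTT itself is the case of one anchor and no further rules.

Congruence of the formers in arguments without bound variables follows from `substCong`;
congruence in arguments with bound variables is stated. -/

open Tm Judg in
inductive Der {S : Ops.{u}} {X : Type v} (R : List (X × Judg S) → X × Judg S → Prop) :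
    X → Judg S → Prop
  /-- The rules that are specific to the theory. -/
  | step {ps : List (X × Judg S)} {a : X} {J : Judg S} (h : R ps (a, J))
      (d : ∀ p ∈ ps, Der R p.1 p.2) : Der R a J
  -- contexts and variables
  | ctxNil {a : X} : Der R a (ctx .nil)
  | ctxSnoc {a : X} {n i : ℕ} {Γ : Ctx S n} {A : Tm S n} :
      Der R a (tm Γ A (U i)) → Der R a (ctx (Γ.snoc A))
  | var {a : X} {n : ℕ} {Γ : Ctx S n} (k : Fin n) :
      Der R a (ctx Γ) → Der R a (tm Γ (.var k) (Γ.get k))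
  -- weakening and substitution
  | weak {a : X} {n i : ℕ} {Γ : Ctx S n} {A t B : Tm S n} :
      Der R a (tm Γ A (U i)) → Der R a (tm Γ t B) → Der R a (tm (Γ.snoc A) t.wk B.wk)
  | weakEq {a : X} {n i : ℕ} {Γ : Ctx S n} {A t s B : Tm S n} :
      Der R a (tm Γ A (U i)) → Der R a (eq Γ t s B) →
      Der R a (eq (Γ.snoc A) t.wk s.wk B.wk)
  | subst {a : X} {n : ℕ} {Γ : Ctx S n} {A r : Tm S n} {t B : Tm S (n + 1)} :
      Der R a (tm Γ r A) → Der R a (tm (Γ.snoc A) t B) →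
      Der R a (tm Γ (t.inst r) (B.inst r))
  | substEq {a : X} {n : ℕ} {Γ : Ctx S n} {A r : Tm S n} {t s B : Tm S (n + 1)} :
      Der R a (tm Γ r A) → Der R a (eq (Γ.snoc A) t s B) →
      Der R a (eq Γ (t.inst r) (s.inst r) (B.inst r))
  | substCong {a : X} {n : ℕ} {Γ : Ctx S n} {A r r' : Tm S n} {t B : Tm S (n + 1)} :
      Der R a (eq Γ r r' A) → Der R a (tm (Γ.snoc A) t B) →
      Der R a (eq Γ (t.inst r) (t.inst r') (B.inst r))
  -- judgemental equality
  | eqRefl {a : X} {n : ℕ} {Γ : Ctx S n} {t A : Tm S n} :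
      Der R a (tm Γ t A) → Der R a (eq Γ t t A)
  | eqSymm {a : X} {n : ℕ} {Γ : Ctx S n} {t s A : Tm S n} :
      Der R a (eq Γ t s A) → Der R a (eq Γ s t A)
  | eqTrans {a : X} {n : ℕ} {Γ : Ctx S n} {t s r A : Tm S n} :
      Der R a (eq Γ t s A) → Der R a (eq Γ s r A) → Der R a (eq Γ t r A)
  | conv {a : X} {n i : ℕ} {Γ : Ctx S n} {t A B : Tm S n} :
      Der R a (tm Γ t A) → Der R a (eq Γ A B (U i)) → Der R a (tm Γ t B)
  | convEq {a : X} {n i : ℕ} {Γ : Ctx S n} {t s A B : Tm S n} :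
      Der R a (eq Γ t s A) → Der R a (eq Γ A B (U i)) → Der R a (eq Γ t s B)
  -- types and universes
  | tyOfU {a : X} {n i : ℕ} {Γ : Ctx S n} {A : Tm S n} :
      Der R a (tm Γ A (U i)) → Der R a (ty Γ A)
  | univ {a : X} {n i : ℕ} {Γ : Ctx S n} :
      Der R a (ctx Γ) → Der R a (tm Γ (U i) (U (i + 1)))
  | cumul {a : X} {n i : ℕ} {Γ : Ctx S n} {A : Tm S n} :
      Der R a (tm Γ A (U i)) → Der R a (tm Γ A (U (i + 1)))
  | cumulEq {a : X} {n i : ℕ} {Γ : Ctx S n} {A B : Tm S n} :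
      Der R a (eq Γ A B (U i)) → Der R a (eq Γ A B (U (i + 1)))
  -- dependent functions
  | piForm {a : X} {n i : ℕ} {Γ : Ctx S n} {A : Tm S n} {B : Tm S (n + 1)} :
      Der R a (tm Γ A (U i)) → Der R a (tm (Γ.snoc A) B (U i)) →
      Der R a (tm Γ (pi A B) (U i))
  | piCong {a : X} {n i : ℕ} {Γ : Ctx S n} {A A' : Tm S n} {B B' : Tm S (n + 1)} :
      Der R a (tm Γ A (U i)) → Der R a (eq Γ A A' (U i)) →
      Der R a (eq (Γ.snoc A) B B' (U i)) → Der R a (eq Γ (pi A B) (pi A' B') (U i))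
  | lam {a : X} {n i : ℕ} {Γ : Ctx S n} {A : Tm S n} {b B : Tm S (n + 1)} :
      Der R a (tm Γ A (U i)) → Der R a (tm (Γ.snoc A) b B) →
      Der R a (tm Γ (.lam A b) (pi A B))
  | lamCong {a : X} {n i : ℕ} {Γ : Ctx S n} {A A' : Tm S n} {b b' B : Tm S (n + 1)} :
      Der R a (tm Γ A (U i)) → Der R a (eq Γ A A' (U i)) →
      Der R a (eq (Γ.snoc A) b b' B) → Der R a (eq Γ (.lam A b) (.lam A' b') (pi A B))
  | app {a : X} {n : ℕ} {Γ : Ctx S n} {A f t : Tm S n} {B : Tm S (n + 1)} :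
      Der R a (tm Γ f (pi A B)) → Der R a (tm Γ t A) →
      Der R a (tm Γ (.app f t) (B.inst t))
  | piBeta {a : X} {n i : ℕ} {Γ : Ctx S n} {A t : Tm S n} {b B : Tm S (n + 1)} :
      Der R a (tm Γ A (U i)) → Der R a (tm (Γ.snoc A) b B) → Der R a (tm Γ t A) →
      Der R a (eq Γ (.app (.lam A b) t) (b.inst t) (B.inst t))
  | piEta {a : X} {n : ℕ} {Γ : Ctx S n} {A f : Tm S n} {B : Tm S (n + 1)} :
      Der R a (tm Γ f (pi A B)) →
      Der R a (eq Γ f (.lam A (.app f.wk (.var 0))) (pi A B))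
  -- dependent pairs
  | sigmaForm {a : X} {n i : ℕ} {Γ : Ctx S n} {A : Tm S n} {B : Tm S (n + 1)} :
      Der R a (tm Γ A (U i)) → Der R a (tm (Γ.snoc A) B (U i)) →
      Der R a (tm Γ (sigma A B) (U i))
  | sigmaCong {a : X} {n i : ℕ} {Γ : Ctx S n} {A A' : Tm S n} {B B' : Tm S (n + 1)} :
      Der R a (tm Γ A (U i)) → Der R a (eq Γ A A' (U i)) →
      Der R a (eq (Γ.snoc A) B B' (U i)) → Der R a (eq Γ (sigma A B) (sigma A' B') (U i))
  | pair {a : X} {n i : ℕ} {Γ : Ctx S n} {A s t : Tm S n} {B : Tm S (n + 1)} :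
      Der R a (tm (Γ.snoc A) B (U i)) → Der R a (tm Γ s A) → Der R a (tm Γ t (B.inst s)) →
      Der R a (tm Γ (.pair s t) (sigma A B))
  | fst {a : X} {n : ℕ} {Γ : Ctx S n} {A p : Tm S n} {B : Tm S (n + 1)} :
      Der R a (tm Γ p (sigma A B)) → Der R a (tm Γ (.fst p) A)
  | snd {a : X} {n : ℕ} {Γ : Ctx S n} {A p : Tm S n} {B : Tm S (n + 1)} :
      Der R a (tm Γ p (sigma A B)) → Der R a (tm Γ (.snd p) (B.inst (.fst p)))
  | fstBeta {a : X} {n i : ℕ} {Γ : Ctx S n} {A s t : Tm S n} {B : Tm S (n + 1)} :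
      Der R a (tm (Γ.snoc A) B (U i)) → Der R a (tm Γ s A) → Der R a (tm Γ t (B.inst s)) →
      Der R a (eq Γ (.fst (.pair s t)) s A)
  | sndBeta {a : X} {n i : ℕ} {Γ : Ctx S n} {A s t : Tm S n} {B : Tm S (n + 1)} :
      Der R a (tm (Γ.snoc A) B (U i)) → Der R a (tm Γ s A) → Der R a (tm Γ t (B.inst s)) →
      Der R a (eq Γ (.snd (.pair s t)) t (B.inst s))
  | sigmaEta {a : X} {n : ℕ} {Γ : Ctx S n} {A p : Tm S n} {B : Tm S (n + 1)} :
      Der R a (tm Γ p (sigma A B)) → Der R a (eq Γ p (.pair (.fst p) (.snd p)) (sigma A B))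
  -- the empty type
  | emptyForm {a : X} {n : ℕ} {Γ : Ctx S n} : Der R a (ctx Γ) → Der R a (tm Γ empty (U 0))
  | emptyInd {a : X} {n i : ℕ} {Γ : Ctx S n} {e : Tm S n} {C : Tm S (n + 1)} :
      Der R a (tm (Γ.snoc empty) C (U i)) → Der R a (tm Γ e empty) →
      Der R a (tm Γ (.emptyInd C e) (C.inst e))
  | emptyIndCong {a : X} {n i : ℕ} {Γ : Ctx S n} {e : Tm S n} {C C' : Tm S (n + 1)} :
      Der R a (eq (Γ.snoc empty) C C' (U i)) → Der R a (tm Γ e empty) →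
      Der R a (eq Γ (.emptyInd C e) (.emptyInd C' e) (C.inst e))
  -- the unit type
  | unitForm {a : X} {n : ℕ} {Γ : Ctx S n} : Der R a (ctx Γ) → Der R a (tm Γ unit (U 0))
  | star {a : X} {n : ℕ} {Γ : Ctx S n} : Der R a (ctx Γ) → Der R a (tm Γ .star unit)
  | unitEta {a : X} {n : ℕ} {Γ : Ctx S n} {t : Tm S n} :
      Der R a (tm Γ t unit) → Der R a (eq Γ t .star unit)
  -- coproducts
  | sumForm {a : X} {n i : ℕ} {Γ : Ctx S n} {A B : Tm S n} :
      Der R a (tm Γ A (U i)) → Der R a (tm Γ B (U i)) → Der R a (tm Γ (sum A B) (U i))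
  | inl {a : X} {n i : ℕ} {Γ : Ctx S n} {A B t : Tm S n} :
      Der R a (tm Γ A (U i)) → Der R a (tm Γ B (U i)) → Der R a (tm Γ t A) →
      Der R a (tm Γ (.inl t) (sum A B))
  | inr {a : X} {n i : ℕ} {Γ : Ctx S n} {A B t : Tm S n} :
      Der R a (tm Γ A (U i)) → Der R a (tm Γ B (U i)) → Der R a (tm Γ t B) →
      Der R a (tm Γ (.inr t) (sum A B))
  | sumInd {a : X} {n i : ℕ} {Γ : Ctx S n} {A B e : Tm S n} {C c d : Tm S (n + 1)} :
      Der R a (tm (Γ.snoc (sum A B)) C (U i)) →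
      Der R a (tm (Γ.snoc A) c (C.at₁ (.inl (.var 0)))) →
      Der R a (tm (Γ.snoc B) d (C.at₁ (.inr (.var 0)))) →
      Der R a (tm Γ e (sum A B)) → Der R a (tm Γ (.sumInd C c d e) (C.inst e))
  | sumIndCong {a : X} {n i : ℕ} {Γ : Ctx S n} {A B e : Tm S n}
      {C C' c c' d d' : Tm S (n + 1)} :
      Der R a (eq (Γ.snoc (sum A B)) C C' (U i)) →
      Der R a (eq (Γ.snoc A) c c' (C.at₁ (.inl (.var 0)))) →
      Der R a (eq (Γ.snoc B) d d' (C.at₁ (.inr (.var 0)))) →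
      Der R a (tm Γ e (sum A B)) →
      Der R a (eq Γ (.sumInd C c d e) (.sumInd C' c' d' e) (C.inst e))
  | sumBetaL {a : X} {n i : ℕ} {Γ : Ctx S n} {A B t : Tm S n} {C c d : Tm S (n + 1)} :
      Der R a (tm (Γ.snoc (sum A B)) C (U i)) →
      Der R a (tm (Γ.snoc A) c (C.at₁ (.inl (.var 0)))) →
      Der R a (tm (Γ.snoc B) d (C.at₁ (.inr (.var 0)))) →
      Der R a (tm Γ t A) →
      Der R a (eq Γ (.sumInd C c d (.inl t)) (c.inst t) (C.inst (.inl t)))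
  | sumBetaR {a : X} {n i : ℕ} {Γ : Ctx S n} {A B t : Tm S n} {C c d : Tm S (n + 1)} :
      Der R a (tm (Γ.snoc (sum A B)) C (U i)) →
      Der R a (tm (Γ.snoc A) c (C.at₁ (.inl (.var 0)))) →
      Der R a (tm (Γ.snoc B) d (C.at₁ (.inr (.var 0)))) →
      Der R a (tm Γ t B) →
      Der R a (eq Γ (.sumInd C c d (.inr t)) (d.inst t) (C.inst (.inr t)))
  -- natural numbers
  | natForm {a : X} {n : ℕ} {Γ : Ctx S n} : Der R a (ctx Γ) → Der R a (tm Γ nat (U 0))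
  | zero {a : X} {n : ℕ} {Γ : Ctx S n} : Der R a (ctx Γ) → Der R a (tm Γ .zero nat)
  | succ {a : X} {n : ℕ} {Γ : Ctx S n} {k : Tm S n} :
      Der R a (tm Γ k nat) → Der R a (tm Γ (.succ k) nat)
  | natInd {a : X} {n i : ℕ} {Γ : Ctx S n} {C : Tm S (n + 1)} {z k : Tm S n}
      {s : Tm S (n + 2)} :
      Der R a (tm (Γ.snoc nat) C (U i)) → Der R a (tm Γ z (C.inst .zero)) →
      Der R a (tm ((Γ.snoc nat).snoc C) s (C.at₂ (.succ (.var 1)))) →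
      Der R a (tm Γ k nat) → Der R a (tm Γ (.natInd C z s k) (C.inst k))
  | natIndCong {a : X} {n i : ℕ} {Γ : Ctx S n} {C C' : Tm S (n + 1)} {z z' k : Tm S n}
      {s s' : Tm S (n + 2)} :
      Der R a (eq (Γ.snoc nat) C C' (U i)) → Der R a (eq Γ z z' (C.inst .zero)) →
      Der R a (eq ((Γ.snoc nat).snoc C) s s' (C.at₂ (.succ (.var 1)))) →
      Der R a (tm Γ k nat) →
      Der R a (eq Γ (.natInd C z s k) (.natInd C' z' s' k) (C.inst k))
  | natBetaZ {a : X} {n i : ℕ} {Γ : Ctx S n} {C : Tm S (n + 1)} {z : Tm S n}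
      {s : Tm S (n + 2)} :
      Der R a (tm (Γ.snoc nat) C (U i)) → Der R a (tm Γ z (C.inst .zero)) →
      Der R a (tm ((Γ.snoc nat).snoc C) s (C.at₂ (.succ (.var 1)))) →
      Der R a (eq Γ (.natInd C z s .zero) z (C.inst .zero))
  | natBetaS {a : X} {n i : ℕ} {Γ : Ctx S n} {C : Tm S (n + 1)} {z k : Tm S n}
      {s : Tm S (n + 2)} :
      Der R a (tm (Γ.snoc nat) C (U i)) → Der R a (tm Γ z (C.inst .zero)) →
      Der R a (tm ((Γ.snoc nat).snoc C) s (C.at₂ (.succ (.var 1)))) →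
      Der R a (tm Γ k nat) →
      Der R a (eq Γ (.natInd C z s (.succ k)) (s.inst₂ k (.natInd C z s k))
        (C.inst (.succ k)))
  -- lists
  | listForm {a : X} {n i : ℕ} {Γ : Ctx S n} {A : Tm S n} :
      Der R a (tm Γ A (U i)) → Der R a (tm Γ (list A) (U i))
  | nil {a : X} {n i : ℕ} {Γ : Ctx S n} {A : Tm S n} :
      Der R a (tm Γ A (U i)) → Der R a (tm Γ .nil (list A))
  | cons {a : X} {n i : ℕ} {Γ : Ctx S n} {A t l : Tm S n} :
      Der R a (tm Γ A (U i)) → Der R a (tm Γ t A) → Der R a (tm Γ l (list A)) →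
      Der R a (tm Γ (.cons t l) (list A))
  | listInd {a : X} {n i : ℕ} {Γ : Ctx S n} {A : Tm S n} {C : Tm S (n + 1)} {z l : Tm S n}
      {s : Tm S (n + 3)} :
      Der R a (tm (Γ.snoc (list A)) C (U i)) → Der R a (tm Γ z (C.inst .nil)) →
      Der R a (tm (((Γ.snoc A).snoc (list A).wk).snoc (C.at₂ (.var 0))) s
        (C.at₃ (.cons (.var 2) (.var 1)))) →
      Der R a (tm Γ l (list A)) → Der R a (tm Γ (.listInd C z s l) (C.inst l))
  | listIndCong {a : X} {n i : ℕ} {Γ : Ctx S n} {A : Tm S n} {C C' : Tm S (n + 1)}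
      {z z' l : Tm S n} {s s' : Tm S (n + 3)} :
      Der R a (eq (Γ.snoc (list A)) C C' (U i)) → Der R a (eq Γ z z' (C.inst .nil)) →
      Der R a (eq (((Γ.snoc A).snoc (list A).wk).snoc (C.at₂ (.var 0))) s s'
        (C.at₃ (.cons (.var 2) (.var 1)))) →
      Der R a (tm Γ l (list A)) →
      Der R a (eq Γ (.listInd C z s l) (.listInd C' z' s' l) (C.inst l))
  | listBetaN {a : X} {n i : ℕ} {Γ : Ctx S n} {A : Tm S n} {C : Tm S (n + 1)} {z : Tm S n}
      {s : Tm S (n + 3)} :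
      Der R a (tm (Γ.snoc (list A)) C (U i)) → Der R a (tm Γ z (C.inst .nil)) →
      Der R a (tm (((Γ.snoc A).snoc (list A).wk).snoc (C.at₂ (.var 0))) s
        (C.at₃ (.cons (.var 2) (.var 1)))) →
      Der R a (eq Γ (.listInd C z s .nil) z (C.inst .nil))
  | listBetaC {a : X} {n i : ℕ} {Γ : Ctx S n} {A : Tm S n} {C : Tm S (n + 1)}
      {z t l : Tm S n} {s : Tm S (n + 3)} :
      Der R a (tm (Γ.snoc (list A)) C (U i)) → Der R a (tm Γ z (C.inst .nil)) →
      Der R a (tm (((Γ.snoc A).snoc (list A).wk).snoc (C.at₂ (.var 0))) s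
        (C.at₃ (.cons (.var 2) (.var 1)))) →
      Der R a (tm Γ t A) → Der R a (tm Γ l (list A)) →
      Der R a (eq Γ (.listInd C z s (.cons t l)) (s.inst₃ t l (.listInd C z s l))
        (C.inst (.cons t l)))
  -- identity types
  | idForm {a : X} {n i : ℕ} {Γ : Ctx S n} {A s t : Tm S n} :
      Der R a (tm Γ A (U i)) → Der R a (tm Γ s A) → Der R a (tm Γ t A) →
      Der R a (tm Γ (id A s t) (U i))
  | refl {a : X} {n : ℕ} {Γ : Ctx S n} {A t : Tm S n} :
      Der R a (tm Γ t A) → Der R a (tm Γ (.refl t) (id A t t))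
  | J {a : X} {n i : ℕ} {Γ : Ctx S n} {A s t p c : Tm S n} {C : Tm S (n + 2)} :
      Der R a (tm Γ s A) →
      Der R a (tm ((Γ.snoc A).snoc (id A.wk s.wk (.var 0))) C (U i)) →
      Der R a (tm Γ c (C.inst₂ s (.refl s))) →
      Der R a (tm Γ t A) → Der R a (tm Γ p (id A s t)) →
      Der R a (tm Γ (.J C c t p) (C.inst₂ t p))
  | JCong {a : X} {n i : ℕ} {Γ : Ctx S n} {A s t p c c' : Tm S n} {C C' : Tm S (n + 2)} :
      Der R a (tm Γ s A) →
      Der R a (eq ((Γ.snoc A).snoc (id A.wk s.wk (.var 0))) C C' (U i)) →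
      Der R a (eq Γ c c' (C.inst₂ s (.refl s))) →
      Der R a (tm Γ t A) → Der R a (tm Γ p (id A s t)) →
      Der R a (eq Γ (.J C c t p) (.J C' c' t p) (C.inst₂ t p))
  | JBeta {a : X} {n i : ℕ} {Γ : Ctx S n} {A s c : Tm S n} {C : Tm S (n + 2)} :
      Der R a (tm Γ s A) →
      Der R a (tm ((Γ.snoc A).snoc (id A.wk s.wk (.var 0))) C (U i)) →
      Der R a (tm Γ c (C.inst₂ s (.refl s))) →
      Der R a (eq Γ (.J C c s (.refl s)) c (C.inst₂ s (.refl s)))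
  -- function extensionality and univalence
  | funext {a : X} {n i : ℕ} {Γ : Ctx S n} {A f g : Tm S n} {B : Tm S (n + 1)} :
      Der R a (tm Γ A (U i)) → Der R a (tm (Γ.snoc A) B (U i)) →
      Der R a (tm Γ f (pi A B)) → Der R a (tm Γ g (pi A B)) →
      Der R a (tm Γ (.funext A B f g)
        (isEquiv (id (pi A B) f g) (homotopy A B f g) (happly A B f g)))
  | funextCong {a : X} {n i : ℕ} {Γ : Ctx S n} {A A' f g : Tm S n} {B B' : Tm S (n + 1)} :
      Der R a (tm Γ A (U i)) → Der R a (eq Γ A A' (U i)) →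
      Der R a (eq (Γ.snoc A) B B' (U i)) →
      Der R a (tm Γ f (pi A B)) → Der R a (tm Γ g (pi A B)) →
      Der R a (eq Γ (.funext A B f g) (.funext A' B' f g)
        (isEquiv (id (pi A B) f g) (homotopy A B f g) (happly A B f g)))
  | ua {a : X} {n i : ℕ} {Γ : Ctx S n} {A B : Tm S n} :
      Der R a (tm Γ A (U i)) → Der R a (tm Γ B (U i)) →
      Der R a (tm Γ (.ua i A B) (isEquiv (id (U i) A B) (equiv A B) (idToEquiv i A B)))
  -- the circle
  | circleForm {a : X} {n : ℕ} {Γ : Ctx S n} :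
      Der R a (ctx Γ) → Der R a (tm Γ circle (U 0))
  | base {a : X} {n : ℕ} {Γ : Ctx S n} : Der R a (ctx Γ) → Der R a (tm Γ .base circle)
  | loop {a : X} {n : ℕ} {Γ : Ctx S n} :
      Der R a (ctx Γ) → Der R a (tm Γ .loop (id circle .base .base))
  | circleInd {a : X} {n i : ℕ} {Γ : Ctx S n} {b l x : Tm S n} {C : Tm S (n + 1)} :
      Der R a (tm (Γ.snoc circle) C (U i)) → Der R a (tm Γ b (C.inst .base)) →
      Der R a (tm Γ l (id (C.inst .base) (transport C .base .loop b) b)) →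
      Der R a (tm Γ x circle) → Der R a (tm Γ (.circleInd C b l x) (C.inst x))
  | circleIndCong {a : X} {n i : ℕ} {Γ : Ctx S n} {b b' l l' x : Tm S n}
      {C C' : Tm S (n + 1)} :
      Der R a (eq (Γ.snoc circle) C C' (U i)) → Der R a (eq Γ b b' (C.inst .base)) →
      Der R a (eq Γ l l' (id (C.inst .base) (transport C .base .loop b) b)) →
      Der R a (tm Γ x circle) →
      Der R a (eq Γ (.circleInd C b l x) (.circleInd C' b' l' x) (C.inst x))
  | circleBeta {a : X} {n i : ℕ} {Γ : Ctx S n} {b l : Tm S n} {C : Tm S (n + 1)} :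
      Der R a (tm (Γ.snoc circle) C (U i)) → Der R a (tm Γ b (C.inst .base)) →
      Der R a (tm Γ l (id (C.inst .base) (transport C .base .loop b) b)) →
      Der R a (eq Γ (.circleInd C b l .base) b (C.inst .base))
  | circleLoop {a : X} {n i : ℕ} {Γ : Ctx S n} {b l : Tm S n} {C : Tm S (n + 1)} :
      Der R a (tm (Γ.snoc circle) C (U i)) → Der R a (tm Γ b (C.inst .base)) →
      Der R a (tm Γ l (id (C.inst .base) (transport C .base .loop b) b)) →
      Der R a (tm Γ (.circleLoop C b l)
        (id (id (C.inst .base) (transport C .base .loop b) b)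
          (apd C (.circleInd C.wkU b.wk l.wk (.var 0)) .base .base .loop) l))
  | circleLoopCong {a : X} {n i : ℕ} {Γ : Ctx S n} {b b' l l' : Tm S n}
      {C C' : Tm S (n + 1)} :
      Der R a (eq (Γ.snoc circle) C C' (U i)) → Der R a (eq Γ b b' (C.inst .base)) →
      Der R a (eq Γ l l' (id (C.inst .base) (transport C .base .loop b) b)) →
      Der R a (eq Γ (.circleLoop C b l) (.circleLoop C' b' l')
        (id (id (C.inst .base) (transport C .base .loop b) b)
          (apd C (.circleInd C.wkU b.wk l.wk (.var 0)) .base .base .loop) l))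
  -- pushouts
  | pushForm {a : X} {n i : ℕ} {Γ : Ctx S n} {A B D f g : Tm S n} :
      Der R a (tm Γ A (U i)) → Der R a (tm Γ B (U i)) → Der R a (tm Γ D (U i)) →
      Der R a (tm Γ f (arrow D A)) → Der R a (tm Γ g (arrow D B)) →
      Der R a (tm Γ (push A B D f g) (U i))
  | pinl {a : X} {n i : ℕ} {Γ : Ctx S n} {A B D f g t : Tm S n} :
      Der R a (tm Γ (push A B D f g) (U i)) → Der R a (tm Γ t A) →
      Der R a (tm Γ (.pinl t) (push A B D f g))
  | pinr {a : X} {n i : ℕ} {Γ : Ctx S n} {A B D f g t : Tm S n} :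
      Der R a (tm Γ (push A B D f g) (U i)) → Der R a (tm Γ t B) →
      Der R a (tm Γ (.pinr t) (push A B D f g))
  | pglue {a : X} {n i : ℕ} {Γ : Ctx S n} {A B D f g t : Tm S n} :
      Der R a (tm Γ (push A B D f g) (U i)) → Der R a (tm Γ t D) →
      Der R a (tm Γ (.pglue t)
        (id (push A B D f g) (.pinl (.app f t)) (.pinr (.app g t))))
  | pushInd {a : X} {n i : ℕ} {Γ : Ctx S n} {A B D f g x : Tm S n}
      {C l r k : Tm S (n + 1)} :
      Der R a (tm (Γ.snoc (push A B D f g)) C (U i)) →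
      Der R a (tm (Γ.snoc A) l (C.at₁ (.pinl (.var 0)))) →
      Der R a (tm (Γ.snoc B) r (C.at₁ (.pinr (.var 0)))) →
      Der R a (tm (Γ.snoc D) k
        (id (C.at₁ (.pinr (.app g.wk (.var 0))))
          (transport C.wkU (.pinr (.app g.wk (.var 0))) (.pglue (.var 0))
            (l.at₁ (.app f.wk (.var 0))))
          (r.at₁ (.app g.wk (.var 0))))) →
      Der R a (tm Γ x (push A B D f g)) →
      Der R a (tm Γ (.pushInd C l r k x) (C.inst x))
  | pushIndCong {a : X} {n i : ℕ} {Γ : Ctx S n} {A B D f g x : Tm S n}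
      {C C' l l' r r' k k' : Tm S (n + 1)} :
      Der R a (eq (Γ.snoc (push A B D f g)) C C' (U i)) →
      Der R a (eq (Γ.snoc A) l l' (C.at₁ (.pinl (.var 0)))) →
      Der R a (eq (Γ.snoc B) r r' (C.at₁ (.pinr (.var 0)))) →
      Der R a (eq (Γ.snoc D) k k'
        (id (C.at₁ (.pinr (.app g.wk (.var 0))))
          (transport C.wkU (.pinr (.app g.wk (.var 0))) (.pglue (.var 0))
            (l.at₁ (.app f.wk (.var 0))))
          (r.at₁ (.app g.wk (.var 0))))) →
      Der R a (tm Γ x (push A B D f g)) →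
      Der R a (eq Γ (.pushInd C l r k x) (.pushInd C' l' r' k' x) (C.inst x))
  | pushBetaL {a : X} {n i : ℕ} {Γ : Ctx S n} {A B D f g t : Tm S n}
      {C l r k : Tm S (n + 1)} :
      Der R a (tm (Γ.snoc (push A B D f g)) C (U i)) →
      Der R a (tm (Γ.snoc A) l (C.at₁ (.pinl (.var 0)))) →
      Der R a (tm (Γ.snoc B) r (C.at₁ (.pinr (.var 0)))) →
      Der R a (tm (Γ.snoc D) k
        (id (C.at₁ (.pinr (.app g.wk (.var 0))))
          (transport C.wkU (.pinr (.app g.wk (.var 0))) (.pglue (.var 0))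
            (l.at₁ (.app f.wk (.var 0))))
          (r.at₁ (.app g.wk (.var 0))))) →
      Der R a (tm Γ t A) →
      Der R a (eq Γ (.pushInd C l r k (.pinl t)) (l.inst t) (C.inst (.pinl t)))
  | pushBetaR {a : X} {n i : ℕ} {Γ : Ctx S n} {A B D f g t : Tm S n}
      {C l r k : Tm S (n + 1)} :
      Der R a (tm (Γ.snoc (push A B D f g)) C (U i)) →
      Der R a (tm (Γ.snoc A) l (C.at₁ (.pinl (.var 0)))) →
      Der R a (tm (Γ.snoc B) r (C.at₁ (.pinr (.var 0)))) →
      Der R a (tm (Γ.snoc D) k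
        (id (C.at₁ (.pinr (.app g.wk (.var 0))))
          (transport C.wkU (.pinr (.app g.wk (.var 0))) (.pglue (.var 0))
            (l.at₁ (.app f.wk (.var 0))))
          (r.at₁ (.app g.wk (.var 0))))) →
      Der R a (tm Γ t B) →
      Der R a (eq Γ (.pushInd C l r k (.pinr t)) (r.inst t) (C.inst (.pinr t)))
  | pushGlue {a : X} {n i : ℕ} {Γ : Ctx S n} {A B D f g t : Tm S n}
      {C l r k : Tm S (n + 1)} :
      Der R a (tm (Γ.snoc (push A B D f g)) C (U i)) →
      Der R a (tm (Γ.snoc A) l (C.at₁ (.pinl (.var 0)))) →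
      Der R a (tm (Γ.snoc B) r (C.at₁ (.pinr (.var 0)))) →
      Der R a (tm (Γ.snoc D) k
        (id (C.at₁ (.pinr (.app g.wk (.var 0))))
          (transport C.wkU (.pinr (.app g.wk (.var 0))) (.pglue (.var 0))
            (l.at₁ (.app f.wk (.var 0))))
          (r.at₁ (.app g.wk (.var 0))))) →
      Der R a (tm Γ t D) →
      Der R a (tm Γ (.pushGlue C l r k t)
        (id (id (C.inst (.pinr (.app g t)))
            (transport C (.pinr (.app g t)) (.pglue t) (l.inst (.app f t)))
            (r.inst (.app g t)))
          (apd C (.pushInd C.wkU l.wkU r.wkU k.wkU (.var 0)) (.pinl (.app f t))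
            (.pinr (.app g t)) (.pglue t))
          (k.inst t)))
  | pushGlueCong {a : X} {n i : ℕ} {Γ : Ctx S n} {A B D f g t : Tm S n}
      {C C' l l' r r' k k' : Tm S (n + 1)} :
      Der R a (eq (Γ.snoc (push A B D f g)) C C' (U i)) →
      Der R a (eq (Γ.snoc A) l l' (C.at₁ (.pinl (.var 0)))) →
      Der R a (eq (Γ.snoc B) r r' (C.at₁ (.pinr (.var 0)))) →
      Der R a (eq (Γ.snoc D) k k'
        (id (C.at₁ (.pinr (.app g.wk (.var 0))))
          (transport C.wkU (.pinr (.app g.wk (.var 0))) (.pglue (.var 0))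
            (l.at₁ (.app f.wk (.var 0))))
          (r.at₁ (.app g.wk (.var 0))))) →
      Der R a (tm Γ t D) →
      Der R a (eq Γ (.pushGlue C l r k t) (.pushGlue C' l' r' k' t)
        (id (id (C.inst (.pinr (.app g t)))
            (transport C (.pinr (.app g t)) (.pglue t) (l.inst (.app f t)))
            (r.inst (.app g t)))
          (apd C (.pushInd C.wkU l.wkU r.wkU k.wkU (.var 0)) (.pinl (.app f t))
            (.pinr (.app g t)) (.pglue t))
          (k.inst t)))
  -- propositional truncation
  | truncForm {a : X} {n i : ℕ} {Γ : Ctx S n} {A : Tm S n} :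
      Der R a (tm Γ A (U i)) → Der R a (tm Γ (trunc A) (U i))
  | tin {a : X} {n i : ℕ} {Γ : Ctx S n} {A t : Tm S n} :
      Der R a (tm Γ A (U i)) → Der R a (tm Γ t A) → Der R a (tm Γ (.tin t) (trunc A))
  | tpath {a : X} {n : ℕ} {Γ : Ctx S n} {A x y : Tm S n} :
      Der R a (tm Γ x (trunc A)) → Der R a (tm Γ y (trunc A)) →
      Der R a (tm Γ (.tpath x y) (id (trunc A) x y))
  | truncInd {a : X} {n i : ℕ} {Γ : Ctx S n} {A x : Tm S n} {C t : Tm S (n + 1)}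
      {s : Tm S (n + 4)} :
      Der R a (tm (Γ.snoc (trunc A)) C (U i)) →
      Der R a (tm (Γ.snoc A) t (C.at₁ (.tin (.var 0)))) →
      Der R a (tm ((((Γ.snoc (trunc A)).snoc (trunc A).wk).snoc (C.at₂ (.var 1))).snoc
          (C.at₃ (.var 1))) s
        (id (C.at₄ (.var 2))
          (transport C.wkU.wkU.wkU.wkU (.var 2) (.tpath (.var 3) (.var 2)) (.var 1))
          (.var 0))) →
      Der R a (tm Γ x (trunc A)) → Der R a (tm Γ (.truncInd C t s x) (C.inst x))
  | truncIndCong {a : X} {n i : ℕ} {Γ : Ctx S n} {A x : Tm S n} {C C' t t' : Tm S (n + 1)}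
      {s s' : Tm S (n + 4)} :
      Der R a (eq (Γ.snoc (trunc A)) C C' (U i)) →
      Der R a (eq (Γ.snoc A) t t' (C.at₁ (.tin (.var 0)))) →
      Der R a (eq ((((Γ.snoc (trunc A)).snoc (trunc A).wk).snoc (C.at₂ (.var 1))).snoc
          (C.at₃ (.var 1))) s s'
        (id (C.at₄ (.var 2))
          (transport C.wkU.wkU.wkU.wkU (.var 2) (.tpath (.var 3) (.var 2)) (.var 1))
          (.var 0))) →
      Der R a (tm Γ x (trunc A)) →
      Der R a (eq Γ (.truncInd C t s x) (.truncInd C' t' s' x) (C.inst x))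
  | truncBeta {a : X} {n i : ℕ} {Γ : Ctx S n} {A r : Tm S n} {C t : Tm S (n + 1)}
      {s : Tm S (n + 4)} :
      Der R a (tm (Γ.snoc (trunc A)) C (U i)) →
      Der R a (tm (Γ.snoc A) t (C.at₁ (.tin (.var 0)))) →
      Der R a (tm ((((Γ.snoc (trunc A)).snoc (trunc A).wk).snoc (C.at₂ (.var 1))).snoc
          (C.at₃ (.var 1))) s
        (id (C.at₄ (.var 2))
          (transport C.wkU.wkU.wkU.wkU (.var 2) (.tpath (.var 3) (.var 2)) (.var 1))
          (.var 0))) →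
      Der R a (tm Γ r A) →
      Der R a (eq Γ (.truncInd C t s (.tin r)) (t.inst r) (C.inst (.tin r)))

/-! ## HoTT -/

/-- HoTT has no operation symbols beyond the core formers. -/
def coreOps : Ops.{0} := ⟨Empty, Empty.elim⟩

/-- Judgements of HoTT. -/
abbrev HoTTJudg : Type := Judg coreOps

/-- Derivability in HoTT. -/
def HoTTDerivable (J : HoTTJudg) : Prop :=
  Der (X := Unit) (fun _ _ => False) () J

/-! ## Evolving texts -/

/-- The measured data over a poset of times on which DHoTT depends: the simplicial presheaf
`ET` of Kan complexes, the finite covers of its slices by caps, and the admissibility policy. -/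
structure EvolvingText (T : Type u) [PartialOrder T] where
  /-- The evolving text base, contravariant in time: later slices restrict to earlier ones. -/
  base : Tᵒᵖ ⥤ SSet.{u}
  kan : ∀ τ, SSet.KanComplex (base.obj τ)
  /-- The indices of the caps of the cover at a time. -/
  Cap : T → Type u
  capFinite : ∀ τ, Finite (Cap τ)
  /-- `mem τ μ x`: the vertex `x` of `ET(τ)` lies in the cap `μ`. -/
  mem : ∀ τ, Cap τ → (base.obj (Opposite.op τ)).obj (Opposite.op (SimplexCategory.mk 0)) → Prop
  /-- `link τ μ ν`: the caps overlap and the overlap meets the thresholds of the policy. -/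
  link : ∀ τ, Cap τ → Cap τ → Prop
  /-- The hop bound. -/
  hop : T → ℕ
  /-- The (decidable) admissibility policy on chains of caps. -/
  adm : ∀ τ, List (Cap τ) → Bool
  /-- The possible tags for a missing face or horn that is identified by a chain. -/
  Face : ∀ τ, List (Cap τ) → Type u
  /-- Names of the measured fibre-types over the base: labels, decorations, adjacencies, ... -/
  Palette : T → Type u
  /-- The number of base points a measured fibre-type depends on. -/
  paletteArity : ∀ τ, Palette τ → ℕ
  /-- The measured elements of a fibre-type over given vertices. -/
  Item : ∀ τ (P : Palette τ),
    (Fin (paletteArity τ P) →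
      (base.obj (Opposite.op τ)).obj (Opposite.op (SimplexCategory.mk 0))) → Type u

namespace EvolvingText

variable {T : Type u} [PartialOrder T] (E : EvolvingText T)

/-- The simplices of dimension `k` of the slice `ET(τ)`. -/
abbrev Simplex (k : ℕ) (τ : T) : Type u :=
  (E.base.obj (Opposite.op τ)).obj (Opposite.op (SimplexCategory.mk k))

/-- The restriction `ET(τ') → ET(τ)` for `τ ≤ τ'`, on simplices. -/
def restr {k : ℕ} {τ τ' : T} (h : τ ≤ τ') (x : E.Simplex k τ') : E.Simplex k τ :=
  (E.base.map (homOfLE h).op).app (Opposite.op (SimplexCategory.mk k)) x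

/-- The `i`-th face of a simplex. -/
def face {k : ℕ} {τ : T} (i : Fin (k + 2)) (x : E.Simplex (k + 1) τ) : E.Simplex k τ :=
  SimplicialObject.δ (E.base.obj (Opposite.op τ)) i x

/-- The degenerate edge at a vertex. -/
def degen {τ : T} (x : E.Simplex 0 τ) : E.Simplex 1 τ :=
  SimplicialObject.σ (E.base.obj (Opposite.op τ)) 0 x

/-- The source of an edge. -/
def src {τ : T} (e : E.Simplex 1 τ) : E.Simplex 0 τ := E.face 1 e

/-- The target of an edge. -/
def tgt {τ : T} (e : E.Simplex 1 τ) : E.Simplex 0 τ := E.face 0 e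

/-- The path attempts from `x` to `y`: chains of at most `hop + 1` caps, consecutive ones linked,
whose first cap contains `x` and whose last cap contains `y`. -/
structure Attempt (τ : T) (x y : E.Simplex 0 τ) where
  chain : List (E.Cap τ)
  length_le : chain.length ≤ E.hop τ + 1
  head_mem : ∃ μ ∈ chain.head?, E.mem τ μ x
  last_mem : ∃ μ ∈ chain.getLast?, E.mem τ μ y
  linked : chain.IsChain (E.link τ)

end EvolvingText

/-! ## DHoTT: operation symbols -/

section DHoTT

variable {T : Type u} [PartialOrder T]

/-- The operation symbols that DHoTT adds to HoTT. -/
inductive DynOp (E : EvolvingText T) : Type u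
  /-- the type `ET(τ)` -/
  | ET (τ : T)
  /-- the restriction `r_{τ,τ'}` -/
  | res {τ τ' : T} (h : τ ≤ τ')
  /-- the points, paths and 2-cells of `ET(τ)` given by vertices, edges and triangles -/
  | pt (τ : T) (x : E.Simplex 0 τ)
  | edge (τ : T) (e : E.Simplex 1 τ)
  | tri (τ : T) (s : E.Simplex 2 τ)
  /-- transport in a family over `ET(τ)`: arguments family, path, term -/
  | tr (τ : T)
  /-- `PathAttempt(a, b)` and the attempts given by chains of caps -/
  | att (τ : T)
  | chain (τ : T) {x y : E.Simplex 0 τ} (c : E.Attempt τ x y)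
  /-- `Adm(p)` and its decision on chains -/
  | adm (τ : T)
  | admYes (τ : T) {x y : E.Simplex 0 τ} (c : E.Attempt τ x y)
  | admNo (τ : T) {x y : E.Simplex 0 τ} (c : E.Attempt τ x y)
  /-- `OpenHorn(p)` and the tags of chains -/
  | horn (τ : T)
  | tag (τ : T) {x y : E.Simplex 0 τ} (c : E.Attempt τ x y) (f : E.Face τ c.chain)
  /-- the sum of `Rupture(τ → τ'; a)` over all `τ' ≥ τ` and its injections -/
  | rupSum (τ : T)
  | rupIn {τ τ' : T} (h : τ ≤ τ')
  /-- the sum of `Carry^{τ → τ'}(a)` over all `τ' ≥ τ` and its injections -/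
  | carSum (τ : T)
  | carIn {τ τ' : T} (h : τ ≤ τ')
  /-- the measured fibre-types and their elements -/
  | pal (τ : T) (P : E.Palette τ)
  | item (τ : T) (P : E.Palette τ) (x : Fin (E.paletteArity τ P) → E.Simplex 0 τ)
      (i : E.Item τ P x)

/-- The arities of the operation symbols. -/
def DynOp.ar {E : EvolvingText T} : DynOp E → ℕ
  | .ET _ => 0
  | .res _ => 1
  | .pt _ _ => 0
  | .edge _ _ => 0
  | .tri _ _ => 0
  | .tr _ => 3
  | .att _ => 2
  | .chain _ _ => 0
  | .adm _ => 1
  | .admYes _ _ => 0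
  | .admNo _ _ => 0
  | .horn _ => 1
  | .tag _ _ _ => 0
  | .rupSum _ => 1
  | .rupIn _ => 1
  | .carSum _ => 1
  | .carIn _ => 1
  | .pal τ P => E.paletteArity τ P
  | .item _ _ _ _ => 0

/-- The operation symbols of DHoTT over the evolving text `E`. -/
def dynOps (E : EvolvingText T) : Ops.{u} := ⟨DynOp E, DynOp.ar⟩

/-- Raw expressions of DHoTT. -/
abbrev DTm (E : EvolvingText T) (n : ℕ) : Type u := Tm (dynOps E) n

variable {E : EvolvingText T} {n : ℕ}

def tmET (E : EvolvingText T) (τ : T) : DTm E n := .op (S := dynOps E) (.ET τ) ![]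

def tmRes {τ τ' : T} (h : τ ≤ τ') (a : DTm E n) : DTm E n := .op (S := dynOps E) (.res h) ![a]

def tmPt (τ : T) (x : E.Simplex 0 τ) : DTm E n := .op (S := dynOps E) (.pt τ x) ![]

def tmEdge (τ : T) (e : E.Simplex 1 τ) : DTm E n := .op (S := dynOps E) (.edge τ e) ![]

def tmTri (τ : T) (s : E.Simplex 2 τ) : DTm E n := .op (S := dynOps E) (.tri τ s) ![]

def tmTr (τ : T) (C p t : DTm E n) : DTm E n := .op (S := dynOps E) (.tr τ) ![C, p, t]

def tmAtt (τ : T) (a b : DTm E n) : DTm E n := .op (S := dynOps E) (.att τ) ![a, b]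

def tmChain (τ : T) {x y : E.Simplex 0 τ} (c : E.Attempt τ x y) : DTm E n :=
  .op (S := dynOps E) (.chain τ c) ![]

def tmAdm (τ : T) (p : DTm E n) : DTm E n := .op (S := dynOps E) (.adm τ) ![p]

def tmAdmYes (τ : T) {x y : E.Simplex 0 τ} (c : E.Attempt τ x y) : DTm E n :=
  .op (S := dynOps E) (.admYes τ c) ![]

def tmAdmNo (τ : T) {x y : E.Simplex 0 τ} (c : E.Attempt τ x y) : DTm E n :=
  .op (S := dynOps E) (.admNo τ c) ![]

def tmHorn (τ : T) (p : DTm E n) : DTm E n := .op (S := dynOps E) (.horn τ) ![p]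

def tmTag (τ : T) {x y : E.Simplex 0 τ} (c : E.Attempt τ x y) (f : E.Face τ c.chain) :
    DTm E n := .op (S := dynOps E) (.tag τ c f) ![]

def tmRupSum (τ : T) (a : DTm E n) : DTm E n := .op (S := dynOps E) (.rupSum τ) ![a]

def tmRupIn {τ τ' : T} (h : τ ≤ τ') (t : DTm E n) : DTm E n :=
  .op (S := dynOps E) (.rupIn h) ![t]

def tmCarSum (τ : T) (a : DTm E n) : DTm E n := .op (S := dynOps E) (.carSum τ) ![a]

def tmCarIn {τ τ' : T} (h : τ ≤ τ') (t : DTm E n) : DTm E n :=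
  .op (S := dynOps E) (.carIn h) ![t]

def tmPal (τ : T) (P : E.Palette τ) (a : Fin (E.paletteArity τ P) → DTm E n) : DTm E n :=
  .op (S := dynOps E) (.pal τ P) a

def tmItem (τ : T) (P : E.Palette τ) (x : Fin (E.paletteArity τ P) → E.Simplex 0 τ)
    (i : E.Item τ P x) : DTm E n := .op (S := dynOps E) (.item τ P x i) ![]

/-- `Carry^{τ → τ'}(a) := Σ (a' : ET(τ')). r_{τ,τ'}(a') = a`, the path being in `ET(τ)`. -/
def carry {τ τ' : T} (h : τ ≤ τ') (a : DTm E n) : DTm E n :=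
  .sigma (tmET E τ') (.id (tmET E τ) (tmRes h (.var 0)) a.wk)

/-- For `κ : Carry^{τ → τ'}(a)` with path component `ρ : r_{τ,τ'}(a') = a`, the inverse path
`a = r_{τ,τ'}(a')` along which data over `a` is transported to `r_{τ,τ'}(a')`. -/
def carryPath {τ τ' : T} (h : τ ≤ τ') (a κ : DTm E n) : DTm E n :=
  .inv (tmET E τ) (tmRes h (.fst κ)) a (.snd κ)

/-- The composite of `κ₁ : Carry^{τ₀ → τ₁}(a)` and `κ₂ : Carry^{τ₁ → τ₂}(fst κ₁)`: the echo of
`κ₂` with the concatenation of the restriction of the path of `κ₂` and the path of `κ₁`. -/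
def carryComp {τ₀ τ₁ τ₂ : T} (h₁ : τ₀ ≤ τ₁) (h₂ : τ₁ ≤ τ₂) (a κ₁ κ₂ : DTm E n) : DTm E n :=
  .pair (.fst κ₂)
    (.concat (tmET E τ₀) (tmRes (h₁.trans h₂) (.fst κ₂)) a
      (.ap (tmET E τ₀) (tmRes h₁ (.var 0)) (tmRes h₂ (.fst κ₂)) (.fst κ₁) (.snd κ₂))
      (.snd κ₁))

/-- The reindexed family `a' ↦ C(r_{τ,τ'}(a'))` over `ET(τ')`. -/
def upFam {τ τ' : T} (h : τ ≤ τ') (C : DTm E n) : DTm E n :=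
  .lam (tmET E τ') (.app C.wk (tmRes h (.var 0)))

/-- `Rupture(τ → τ'; a) :=
Σ (a' : ET(τ')). Σ (p : PathAttempt(a, r_{τ,τ'}(a'))). (¬ Adm(p)) × OpenHorn(p)`. -/
def rupture {τ τ' : T} (h : τ ≤ τ') (a : DTm E n) : DTm E n :=
  .sigma (tmET E τ')
    (.sigma (tmAtt τ a.wk (tmRes h (.var 0)))
      (.prod (.arrow (tmAdm τ (.var 0)) .empty) (tmHorn τ (.var 0))))

/-- The rupture ledger at `a`: lists whose entries are ruptures or carries of `a` towards times
`τ' ≥ τ`.  Its constructors `empty` and `append` are those of lists. -/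
def ledger (τ : T) (a : DTm E n) : DTm E n := .list (.sum (tmRupSum τ a) (tmCarSum τ a))

/-! ## DHoTT: rules -/

open Tm Judg in
/-- The rules that DHoTT adds to those of HoTT, as premises and conclusion with their anchors.
A family over `ET(τ)` is given by a function from `ET(τ)` to a universe.  The identity types of
`ET(τ)` keep path induction; transport over `ET(τ)` is a former with the judgemental equalities
below, and path induction connects it by a path to the transport defined from `J`.  Congruence
rules for the new symbols are instances of `Der.substCong`. -/
inductive DynRule (E : EvolvingText T) :
    List (T × Judg (dynOps E)) → T × Judg (dynOps E) → Prop
  -- the base and its restriction maps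
  | etForm (σ τ : T) {n : ℕ} (Γ : Ctx (dynOps E) n) :
      DynRule E [(σ, ctx Γ)] (σ, tm Γ (tmET E τ) (U 0))
  | res (σ : T) {τ τ' : T} (h : τ ≤ τ') {n : ℕ} (Γ : Ctx (dynOps E) n) (a : DTm E n) :
      DynRule E [(σ, tm Γ a (tmET E τ'))] (σ, tm Γ (tmRes h a) (tmET E τ))
  | resId (σ τ : T) {n : ℕ} (Γ : Ctx (dynOps E) n) (a : DTm E n) :
      DynRule E [(σ, tm Γ a (tmET E τ))] (σ, eq Γ (tmRes (le_refl τ) a) a (tmET E τ))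
  | resComp (σ : T) {τ τ' τ'' : T} (h : τ ≤ τ') (h' : τ' ≤ τ'') {n : ℕ}
      (Γ : Ctx (dynOps E) n) (a : DTm E n) :
      DynRule E [(σ, tm Γ a (tmET E τ''))]
        (σ, eq Γ (tmRes (h.trans h') a) (tmRes h (tmRes h' a)) (tmET E τ))
  -- points, paths and 2-cells from the simplices of the slice
  | pt (σ τ : T) (x : E.Simplex 0 τ) {n : ℕ} (Γ : Ctx (dynOps E) n) :
      DynRule E [(σ, ctx Γ)] (σ, tm Γ (tmPt τ x) (tmET E τ))
  | resPt (σ : T) {τ τ' : T} (h : τ ≤ τ') (x : E.Simplex 0 τ') {n : ℕ}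
      (Γ : Ctx (dynOps E) n) :
      DynRule E [(σ, ctx Γ)]
        (σ, eq Γ (tmRes h (tmPt τ' x)) (tmPt τ (E.restr h x)) (tmET E τ))
  | edge (σ τ : T) (e : E.Simplex 1 τ) {n : ℕ} (Γ : Ctx (dynOps E) n) :
      DynRule E [(σ, ctx Γ)]
        (σ, tm Γ (tmEdge τ e) (id (tmET E τ) (tmPt τ (E.src e)) (tmPt τ (E.tgt e))))
  | edgeDegen (σ τ : T) (x : E.Simplex 0 τ) {n : ℕ} (Γ : Ctx (dynOps E) n) :
      DynRule E [(σ, ctx Γ)]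
        (σ, eq Γ (tmEdge τ (E.degen x)) (refl (tmPt τ x))
          (id (tmET E τ) (tmPt τ x) (tmPt τ x)))
  | resEdge (σ : T) {τ τ' : T} (h : τ ≤ τ') (e : E.Simplex 1 τ') {n : ℕ}
      (Γ : Ctx (dynOps E) n) :
      DynRule E [(σ, ctx Γ)]
        (σ, eq Γ
          (ap (tmET E τ) (tmRes h (.var 0)) (tmPt τ' (E.src e)) (tmPt τ' (E.tgt e))
            (tmEdge τ' e))
          (tmEdge τ (E.restr h e))
          (id (tmET E τ) (tmRes h (tmPt τ' (E.src e))) (tmRes h (tmPt τ' (E.tgt e)))))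
  | tri (σ τ : T) (s : E.Simplex 2 τ) {n : ℕ} (Γ : Ctx (dynOps E) n) :
      DynRule E [(σ, ctx Γ)]
        (σ, tm Γ (tmTri τ s)
          (id (id (tmET E τ) (tmPt τ (E.src (E.face 1 s))) (tmPt τ (E.tgt (E.face 1 s))))
            (concat (tmET E τ) (tmPt τ (E.src (E.face 2 s))) (tmPt τ (E.tgt (E.face 0 s)))
              (tmEdge τ (E.face 2 s)) (tmEdge τ (E.face 0 s)))
            (tmEdge τ (E.face 1 s))))
  -- transport in families over the base
  | transport (σ τ : T) (i : ℕ) {n : ℕ} (Γ : Ctx (dynOps E) n) (C x y p t : DTm E n) :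
      DynRule E
        [(σ, tm Γ x (tmET E τ)), (σ, tm Γ y (tmET E τ)), (σ, tm Γ p (id (tmET E τ) x y)),
          (σ, tm Γ C (arrow (tmET E τ) (U i))), (σ, tm Γ t (app C x))]
        (σ, tm Γ (tmTr τ C p t) (app C y))
  | transportRefl (σ τ : T) (i : ℕ) {n : ℕ} (Γ : Ctx (dynOps E) n) (C x t : DTm E n) :
      DynRule E
        [(σ, tm Γ x (tmET E τ)), (σ, tm Γ C (arrow (tmET E τ) (U i))),
          (σ, tm Γ t (app C x))]
        (σ, eq Γ (tmTr τ C (refl x) t) t (app C x))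
  | transportConst (σ τ : T) (i : ℕ) {n : ℕ} (Γ : Ctx (dynOps E) n)
      (B x y p t : DTm E n) :
      DynRule E
        [(σ, tm Γ x (tmET E τ)), (σ, tm Γ y (tmET E τ)), (σ, tm Γ p (id (tmET E τ) x y)),
          (σ, tm Γ B (U i)), (σ, tm Γ t B)]
        (σ, eq Γ (tmTr τ (lam (tmET E τ) B.wk) p t) t B)
  | transportConcat (σ τ : T) (i : ℕ) {n : ℕ} (Γ : Ctx (dynOps E) n)
      (C x y z p q t : DTm E n) :
      DynRule E
        [(σ, tm Γ x (tmET E τ)), (σ, tm Γ y (tmET E τ)), (σ, tm Γ z (tmET E τ)),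
          (σ, tm Γ p (id (tmET E τ) x y)), (σ, tm Γ q (id (tmET E τ) y z)),
          (σ, tm Γ C (arrow (tmET E τ) (U i))), (σ, tm Γ t (app C x))]
        (σ, eq Γ (tmTr τ C (concat (tmET E τ) x z p q) t) (tmTr τ C q (tmTr τ C p t))
          (app C z))
  -- carry
  | carryForm {τ τ' : T} (h : τ ≤ τ') {n : ℕ} (Γ : Ctx (dynOps E) n) (a : DTm E n) :
      DynRule E [(τ, tm Γ a (tmET E τ))] (τ, tm Γ (carry h a) (U 0))
  | carryIntro {τ τ' : T} (h : τ ≤ τ') {n : ℕ} (Γ : Ctx (dynOps E) n) (a a' ρ : DTm E n) :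
      DynRule E
        [(τ, tm Γ a (tmET E τ)), (τ', tm Γ a' (tmET E τ')),
          (τ, tm Γ ρ (id (tmET E τ) (tmRes h a') a))]
        (τ, tm Γ (pair a' ρ) (carry h a))
  | carryUse {τ τ' : T} (h : τ ≤ τ') (i : ℕ) {n : ℕ} (Γ : Ctx (dynOps E) n)
      (C a t κ : DTm E n) :
      DynRule E
        [(τ, tm Γ a (tmET E τ)), (τ, tm Γ C (arrow (tmET E τ) (U i))),
          (τ, tm Γ t (app C a)), (τ, tm Γ κ (carry h a))]
        (τ', tm Γ (tmTr τ C (carryPath h a κ) t) (app (upFam h C) (fst κ)))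
  | carryComp {τ₀ τ₁ τ₂ : T} (h₁ : τ₀ ≤ τ₁) (h₂ : τ₁ ≤ τ₂) {n : ℕ} (Γ : Ctx (dynOps E) n)
      (a κ₁ κ₂ : DTm E n) :
      DynRule E
        [(τ₀, tm Γ a (tmET E τ₀)), (τ₀, tm Γ κ₁ (carry h₁ a)),
          (τ₁, tm Γ κ₂ (carry h₂ (fst κ₁)))]
        (τ₀, tm Γ (carryComp h₁ h₂ a κ₁ κ₂) (carry (h₁.trans h₂) a))
  | carryCompUse (σ : T) {τ₀ τ₁ τ₂ : T} (h₁ : τ₀ ≤ τ₁) (h₂ : τ₁ ≤ τ₂) (i : ℕ) {n : ℕ}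
      (Γ : Ctx (dynOps E) n) (C a t κ₁ κ₂ : DTm E n) :
      DynRule E
        [(τ₀, tm Γ a (tmET E τ₀)), (τ₀, tm Γ C (arrow (tmET E τ₀) (U i))),
          (τ₀, tm Γ t (app C a)), (τ₀, tm Γ κ₁ (carry h₁ a)),
          (τ₁, tm Γ κ₂ (carry h₂ (fst κ₁)))]
        (σ, eq Γ
          (tmTr τ₀ C (carryPath (h₁.trans h₂) a (DynHoTT.carryComp h₁ h₂ a κ₁ κ₂)) t)
          (tmTr τ₁ (upFam h₁ C) (carryPath h₂ (fst κ₁) κ₂)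
            (tmTr τ₀ C (carryPath h₁ a κ₁) t))
          (app C (tmRes (h₁.trans h₂) (fst κ₂))))
  | depCarry {τ τ' : T} (h : τ ≤ τ') (i : ℕ) {n : ℕ} (Γ : Ctx (dynOps E) n)
      (a κ : DTm E n) (P t : DTm E (n + 1)) :
      DynRule E
        [(τ, tm Γ a (tmET E τ)), (τ, tm (Γ.snoc (tmET E τ)) P (U i)),
          (τ, tm (Γ.snoc (tmET E τ)) t P), (τ, tm Γ κ (carry h a))]
        (τ', tm Γ (tmTr τ (lam (tmET E τ) P) (carryPath h a κ) (t.inst a))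
          (P.inst (tmRes h (fst κ))))
  -- path attempts, the admissibility policy and open horns
  | attForm (σ τ : T) {n : ℕ} (Γ : Ctx (dynOps E) n) (a b : DTm E n) :
      DynRule E [(σ, tm Γ a (tmET E τ)), (σ, tm Γ b (tmET E τ))]
        (σ, tm Γ (tmAtt τ a b) (U 0))
  | chain (σ τ : T) {x y : E.Simplex 0 τ} (c : E.Attempt τ x y) {n : ℕ}
      (Γ : Ctx (dynOps E) n) :
      DynRule E [(σ, ctx Γ)] (σ, tm Γ (tmChain τ c) (tmAtt τ (tmPt τ x) (tmPt τ y)))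
  | admForm (σ τ : T) {n : ℕ} (Γ : Ctx (dynOps E) n) (a b p : DTm E n) :
      DynRule E [(σ, tm Γ p (tmAtt τ a b))] (σ, tm Γ (tmAdm τ p) (U 0))
  | admYes (σ τ : T) {x y : E.Simplex 0 τ} (c : E.Attempt τ x y)
      (hc : E.adm τ c.chain = true) {n : ℕ} (Γ : Ctx (dynOps E) n) :
      DynRule E [(σ, ctx Γ)] (σ, tm Γ (tmAdmYes τ c) (tmAdm τ (tmChain τ c)))
  | admNo (σ τ : T) {x y : E.Simplex 0 τ} (c : E.Attempt τ x y)
      (hc : E.adm τ c.chain = false) {n : ℕ} (Γ : Ctx (dynOps E) n) :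
      DynRule E [(σ, ctx Γ)]
        (σ, tm Γ (tmAdmNo τ c) (arrow (tmAdm τ (tmChain τ c)) empty))
  | hornForm (σ τ : T) {n : ℕ} (Γ : Ctx (dynOps E) n) (a b p : DTm E n) :
      DynRule E [(σ, tm Γ p (tmAtt τ a b))] (σ, tm Γ (tmHorn τ p) (U 0))
  | tag (σ τ : T) {x y : E.Simplex 0 τ} (c : E.Attempt τ x y) (f : E.Face τ c.chain)
      {n : ℕ} (Γ : Ctx (dynOps E) n) :
      DynRule E [(σ, ctx Γ)] (σ, tm Γ (tmTag τ c f) (tmHorn τ (tmChain τ c)))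
  -- rupture and the entries of the ledger
  | ruptureForm {τ τ' : T} (h : τ ≤ τ') {n : ℕ} (Γ : Ctx (dynOps E) n) (a : DTm E n) :
      DynRule E [(τ, tm Γ a (tmET E τ))] (τ, tm Γ (rupture h a) (U 0))
  | rupSumForm (σ τ : T) {n : ℕ} (Γ : Ctx (dynOps E) n) (a : DTm E n) :
      DynRule E [(σ, tm Γ a (tmET E τ))] (σ, tm Γ (tmRupSum τ a) (U 0))
  | rupIn (σ : T) {τ τ' : T} (h : τ ≤ τ') {n : ℕ} (Γ : Ctx (dynOps E) n) (a t : DTm E n) :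
      DynRule E [(σ, tm Γ a (tmET E τ)), (σ, tm Γ t (rupture h a))]
        (σ, tm Γ (tmRupIn h t) (tmRupSum τ a))
  | carSumForm (σ τ : T) {n : ℕ} (Γ : Ctx (dynOps E) n) (a : DTm E n) :
      DynRule E [(σ, tm Γ a (tmET E τ))] (σ, tm Γ (tmCarSum τ a) (U 0))
  | carIn (σ : T) {τ τ' : T} (h : τ ≤ τ') {n : ℕ} (Γ : Ctx (dynOps E) n) (a t : DTm E n) :
      DynRule E [(σ, tm Γ a (tmET E τ)), (σ, tm Γ t (carry h a))]
        (σ, tm Γ (tmCarIn h t) (tmCarSum τ a))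
  | ledgerForm (σ τ : T) {n : ℕ} (Γ : Ctx (dynOps E) n) (a : DTm E n) :
      DynRule E [(σ, tm Γ a (tmET E τ))] (σ, tm Γ (ledger τ a) (U 0))
  -- the measured fibre-types
  | palForm (σ τ : T) (P : E.Palette τ) {n : ℕ} (Γ : Ctx (dynOps E) n)
      (a : Fin (E.paletteArity τ P) → DTm E n) :
      DynRule E ((σ, ctx Γ) :: List.ofFn (fun k => (σ, tm Γ (a k) (tmET E τ))))
        (σ, tm Γ (tmPal τ P a) (U 0))
  | item (σ τ : T) (P : E.Palette τ) (x : Fin (E.paletteArity τ P) → E.Simplex 0 τ)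
      (i : E.Item τ P x) {n : ℕ} (Γ : Ctx (dynOps E) n) :
      DynRule E [(σ, ctx Γ)]
        (σ, tm Γ (tmItem τ P x i) (tmPal τ P (fun k => tmPt τ (x k))))

/-- `DHoTTDerivable E τ J`: the judgement `J` is derivable in DHoTT at the time `τ`. -/
def DHoTTDerivable (E : EvolvingText T) (τ : T) (J : Judg (dynOps E)) : Prop :=
  Der (DynRule E) τ J

end DHoTT

/-! ## The inclusion of the syntax of HoTT -/

/-- HoTT expressions as expressions over any operation symbols. -/
def Tm.embed : {n : ℕ} → Tm coreOps n → Tm S n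
  | _, .var i => .var i
  | _, .op f _ => Empty.elim f
  | _, .U i => .U i
  | _, .pi A B => .pi A.embed B.embed
  | _, .lam A b => .lam A.embed b.embed
  | _, .app f a => .app f.embed a.embed
  | _, .sigma A B => .sigma A.embed B.embed
  | _, .pair a b => .pair a.embed b.embed
  | _, .fst p => .fst p.embed
  | _, .snd p => .snd p.embed
  | _, .empty => .empty
  | _, .emptyInd C e => .emptyInd C.embed e.embed
  | _, .unit => .unit
  | _, .star => .star
  | _, .sum A B => .sum A.embed B.embed
  | _, .inl a => .inl a.embed
  | _, .inr b => .inr b.embed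
  | _, .sumInd C c d e => .sumInd C.embed c.embed d.embed e.embed
  | _, .nat => .nat
  | _, .zero => .zero
  | _, .succ k => .succ k.embed
  | _, .natInd C z s k => .natInd C.embed z.embed s.embed k.embed
  | _, .list A => .list A.embed
  | _, .nil => .nil
  | _, .cons a l => .cons a.embed l.embed
  | _, .listInd C z s l => .listInd C.embed z.embed s.embed l.embed
  | _, .id A a b => .id A.embed a.embed b.embed
  | _, .refl a => .refl a.embed
  | _, .J C c b p => .J C.embed c.embed b.embed p.embed
  | _, .funext A B f g => .funext A.embed B.embed f.embed g.embed
  | _, .ua i A B => .ua i A.embed B.embed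
  | _, .circle => .circle
  | _, .base => .base
  | _, .loop => .loop
  | _, .circleInd C b l x => .circleInd C.embed b.embed l.embed x.embed
  | _, .circleLoop C b l => .circleLoop C.embed b.embed l.embed
  | _, .push A B D f g => .push A.embed B.embed D.embed f.embed g.embed
  | _, .pinl a => .pinl a.embed
  | _, .pinr b => .pinr b.embed
  | _, .pglue c => .pglue c.embed
  | _, .pushInd C l r k x => .pushInd C.embed l.embed r.embed k.embed x.embed
  | _, .pushGlue C l r k c => .pushGlue C.embed l.embed r.embed k.embed c.embed
  | _, .trunc A => .trunc A.embed
  | _, .tin a => .tin a.embed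
  | _, .tpath x y => .tpath x.embed y.embed
  | _, .truncInd C t s x => .truncInd C.embed t.embed s.embed x.embed

def Ctx.embed : {n : ℕ} → Ctx coreOps n → Ctx S n
  | _, .nil => .nil
  | _, .snoc Γ A => .snoc Γ.embed A.embed

/-- A HoTT judgement read as a judgement over any operation symbols. -/
def Judg.embed : HoTTJudg → Judg S
  | .ctx Γ => .ctx Γ.embed
  | .ty Γ A => .ty Γ.embed A.embed
  | .tm Γ t A => .tm Γ.embed t.embed A.embed
  | .eq Γ t s A => .eq Γ.embed t.embed s.embed A.embed

end DynHoTT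

namespace DynHoTT

/-! ## Renaming and substitution -/

section Substitution

variable {S : Ops.{u}}

theorem liftR_comp {n m k : ℕ} (ρ : Fin n → Fin m) (ρ' : Fin m → Fin k) :
    liftR ρ' ∘ liftR ρ = liftR (ρ' ∘ ρ) := by
  funext i
  cases i using Fin.cases <;> rfl

theorem liftS_comp_liftR {n m k : ℕ} (ρ : Fin n → Fin m) (σ : Fin m → Tm S k) :
    liftS σ ∘ liftR ρ = liftS (σ ∘ ρ) := by
  funext i
  cases i using Fin.cases <;> rfl

theorem liftS_var {n : ℕ} : liftS (Tm.var : Fin n → Tm S n) = Tm.var := by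
  funext i
  cases i using Fin.cases <;> rfl

namespace Tm

/-- The renamings are quantified after the term because the induction hypothesis under a binder is
needed for their lifts. -/
theorem rename_rename {n : ℕ} (t : Tm S n) : ∀ {m k : ℕ} (ρ : Fin n → Fin m) (ρ' : Fin m → Fin k),
    (t.rename ρ).rename ρ' = t.rename (ρ' ∘ ρ) := by
  induction t <;> intros <;> simp_all only [rename, liftR_comp, Function.comp_apply]

theorem subst_rename {n : ℕ} (t : Tm S n) : ∀ {m k : ℕ} (ρ : Fin n → Fin m) (σ : Fin m → Tm S k),
    (t.rename ρ).subst σ = t.subst (σ ∘ ρ) := by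
  induction t <;> intros <;>
    simp_all only [rename, subst, liftS_comp_liftR, Function.comp_apply]

theorem rename_wk {n m : ℕ} (ρ : Fin n → Fin m) (t : Tm S n) :
    t.wk.rename (liftR ρ) = (t.rename ρ).wk := by
  simp only [wk, rename_rename]
  rfl

theorem liftR_comp_liftS {n m k : ℕ} (σ : Fin n → Tm S m) (ρ : Fin m → Fin k) :
    (fun i => (liftS σ i).rename (liftR ρ)) = liftS (fun i => (σ i).rename ρ) := by
  funext i
  cases i using Fin.cases
  · rfl
  · exact rename_wk ρ _

/-- The fusion laws have to come in this order: pushing a renaming or a substitution under a binder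
needs its compatibility with weakening, which is itself an instance of the laws proved before.
Fusion of two substitutions comes last. -/
theorem rename_subst {n : ℕ} (t : Tm S n) : ∀ {m k : ℕ} (σ : Fin n → Tm S m) (ρ : Fin m → Fin k),
    (t.subst σ).rename ρ = t.subst (fun i => (σ i).rename ρ) := by
  induction t <;> intros <;> simp_all only [rename, subst, liftR_comp_liftS]

theorem subst_wk {n m : ℕ} (σ : Fin n → Tm S m) (t : Tm S n) :
    t.wk.subst (liftS σ) = (t.subst σ).wk := by
  simp only [wk, subst_rename, rename_subst]
  rfl

theorem liftS_comp_liftS {n m k : ℕ} (σ : Fin n → Tm S m) (σ' : Fin m → Tm S k) :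
    (fun i => (liftS σ i).subst (liftS σ')) = liftS (fun i => (σ i).subst σ') := by
  funext i
  cases i using Fin.cases
  · rfl
  · exact subst_wk σ' _

theorem subst_subst {n : ℕ} (t : Tm S n) : ∀ {m k : ℕ} (σ : Fin n → Tm S m) (σ' : Fin m → Tm S k),
    (t.subst σ).subst σ' = t.subst (fun i => (σ i).subst σ') := by
  induction t <;> intros <;> simp_all only [subst, liftS_comp_liftS]

theorem subst_var {n : ℕ} (t : Tm S n) : t.subst var = t := by
  induction t <;> simp_all only [subst, liftS_var]

theorem wk_inst {n : ℕ} (t a : Tm S n) : t.wk.inst a = t := by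
  rw [wk, inst, subst_rename]
  exact subst_var t

end Tm

end Substitution

/-! ## Translations between theories -/

/-- An interpretation of the operation symbols of `S` by expressions over `S'`, whose free
variables stand for the arguments. -/
abbrev Interp (S : Ops.{u}) (S' : Ops.{v}) := ∀ f : S.Op, Tm S' (S.ar f)

section Interpretation

variable {S : Ops.{u}} {S' : Ops.{v}}

/-- The translation of expressions along an interpretation of the operation symbols. -/
def Tm.interp (ι : Interp S S') : {n : ℕ} → Tm S n → Tm S' n
  | _, .var i => .var i
  | _, .op f args => (ι f).subst (fun i => (args i).interp ι)
  | _, .U i => .U i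
  | _, .pi A B => .pi (A.interp ι) (B.interp ι)
  | _, .lam A b => .lam (A.interp ι) (b.interp ι)
  | _, .app f a => .app (f.interp ι) (a.interp ι)
  | _, .sigma A B => .sigma (A.interp ι) (B.interp ι)
  | _, .pair a b => .pair (a.interp ι) (b.interp ι)
  | _, .fst p => .fst (p.interp ι)
  | _, .snd p => .snd (p.interp ι)
  | _, .empty => .empty
  | _, .emptyInd C e => .emptyInd (C.interp ι) (e.interp ι)
  | _, .unit => .unit
  | _, .star => .star
  | _, .sum A B => .sum (A.interp ι) (B.interp ι)
  | _, .inl a => .inl (a.interp ι)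
  | _, .inr b => .inr (b.interp ι)
  | _, .sumInd C c d e => .sumInd (C.interp ι) (c.interp ι) (d.interp ι) (e.interp ι)
  | _, .nat => .nat
  | _, .zero => .zero
  | _, .succ k => .succ (k.interp ι)
  | _, .natInd C z s k => .natInd (C.interp ι) (z.interp ι) (s.interp ι) (k.interp ι)
  | _, .list A => .list (A.interp ι)
  | _, .nil => .nil
  | _, .cons a l => .cons (a.interp ι) (l.interp ι)
  | _, .listInd C z s l => .listInd (C.interp ι) (z.interp ι) (s.interp ι) (l.interp ι)
  | _, .id A a b => .id (A.interp ι) (a.interp ι) (b.interp ι)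
  | _, .refl a => .refl (a.interp ι)
  | _, .J C c b p => .J (C.interp ι) (c.interp ι) (b.interp ι) (p.interp ι)
  | _, .funext A B f g => .funext (A.interp ι) (B.interp ι) (f.interp ι) (g.interp ι)
  | _, .ua i A B => .ua i (A.interp ι) (B.interp ι)
  | _, .circle => .circle
  | _, .base => .base
  | _, .loop => .loop
  | _, .circleInd C b l x => .circleInd (C.interp ι) (b.interp ι) (l.interp ι) (x.interp ι)
  | _, .circleLoop C b l => .circleLoop (C.interp ι) (b.interp ι) (l.interp ι)
  | _, .push A B D f g => .push (A.interp ι) (B.interp ι) (D.interp ι) (f.interp ι) (g.interp ι)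
  | _, .pinl a => .pinl (a.interp ι)
  | _, .pinr b => .pinr (b.interp ι)
  | _, .pglue c => .pglue (c.interp ι)
  | _, .pushInd C l r k x =>
      .pushInd (C.interp ι) (l.interp ι) (r.interp ι) (k.interp ι) (x.interp ι)
  | _, .pushGlue C l r k c =>
      .pushGlue (C.interp ι) (l.interp ι) (r.interp ι) (k.interp ι) (c.interp ι)
  | _, .trunc A => .trunc (A.interp ι)
  | _, .tin a => .tin (a.interp ι)
  | _, .tpath x y => .tpath (x.interp ι) (y.interp ι)
  | _, .truncInd C t s x => .truncInd (C.interp ι) (t.interp ι) (s.interp ι) (x.interp ι)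

def Ctx.interp (ι : Interp S S') : {n : ℕ} → Ctx S n → Ctx S' n
  | _, .nil => .nil
  | _, .snoc Γ A => .snoc (Γ.interp ι) (A.interp ι)

def Judg.interp (ι : Interp S S') : Judg S → Judg S'
  | .ctx Γ => .ctx (Γ.interp ι)
  | .ty Γ A => .ty (Γ.interp ι) (A.interp ι)
  | .tm Γ t A => .tm (Γ.interp ι) (t.interp ι) (A.interp ι)
  | .eq Γ t s A => .eq (Γ.interp ι) (t.interp ι) (s.interp ι) (A.interp ι)

variable (ι : Interp S S')

namespace Tm

/-- Only the case of an operation symbol is more than congruence. The variables of `ι f` are exactly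
its argument places, so the renaming acts on the substituted arguments alone, by `rename_subst`. -/
theorem interp_rename {n : ℕ} (t : Tm S n) : ∀ {m : ℕ} (ρ : Fin n → Fin m),
    (t.rename ρ).interp ι = (t.interp ι).rename ρ := by
  induction t <;> intros <;> simp_all only [rename, interp, rename_subst]

theorem interp_wk {n : ℕ} (t : Tm S n) : t.wk.interp ι = (t.interp ι).wk :=
  interp_rename ι t _

theorem interp_wkU {n : ℕ} (t : Tm S (n + 1)) : t.wkU.interp ι = (t.interp ι).wkU :=
  interp_rename ι t _

theorem interp_liftS {n m : ℕ} (σ : Fin n → Tm S m) :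
    (fun i => (liftS σ i).interp ι) = liftS (fun i => (σ i).interp ι) := by
  funext i
  cases i using Fin.cases
  · rfl
  · exact interp_wk ι _

/-- At an operation symbol this is associativity of substitution, `subst_subst`; elsewhere it is
congruence. -/
theorem interp_subst {n : ℕ} (t : Tm S n) : ∀ {m : ℕ} (σ : Fin n → Tm S m),
    (t.subst σ).interp ι = (t.interp ι).subst (fun i => (σ i).interp ι) := by
  induction t <;> intros <;> simp_all only [subst, interp, subst_subst, interp_liftS]

/-! ### Interpretations commute with instantiation and with the derived notions of HoTT. -/

variable {n : ℕ}

theorem interp_inst (C : Tm S (n + 1)) (a : Tm S n) :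
    (C.inst a).interp ι = (C.interp ι).inst (a.interp ι) := by
  rw [inst, interp_subst, inst]
  congr 1
  funext i
  cases i using Fin.cases <;> rfl

theorem interp_inst₂ (C : Tm S (n + 2)) (a b : Tm S n) :
    (C.inst₂ a b).interp ι = (C.interp ι).inst₂ (a.interp ι) (b.interp ι) := by
  rw [inst₂, interp_subst, inst₂]
  congr 1
  funext i
  cases i using Fin.cases with
  | zero => rfl
  | succ i => cases i using Fin.cases <;> rfl

theorem interp_inst₃ (C : Tm S (n + 3)) (a b c : Tm S n) :
    (C.inst₃ a b c).interp ι = (C.interp ι).inst₃ (a.interp ι) (b.interp ι) (c.interp ι) := by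
  rw [inst₃, interp_subst, inst₃]
  congr 1
  funext i
  cases i using Fin.cases with
  | zero => rfl
  | succ i =>
    cases i using Fin.cases with
    | zero => rfl
    | succ i => cases i using Fin.cases <;> rfl

theorem interp_at₁ (C : Tm S (n + 1)) (a : Tm S (n + 1)) :
    (C.at₁ a).interp ι = (C.interp ι).at₁ (a.interp ι) := by
  simp only [at₁, interp_inst, interp_wkU]

theorem interp_at₂ (C : Tm S (n + 1)) (a : Tm S (n + 2)) :
    (C.at₂ a).interp ι = (C.interp ι).at₂ (a.interp ι) := by
  simp only [at₂, interp_inst, interp_wkU]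

theorem interp_at₃ (C : Tm S (n + 1)) (a : Tm S (n + 3)) :
    (C.at₃ a).interp ι = (C.interp ι).at₃ (a.interp ι) := by
  simp only [at₃, interp_inst, interp_wkU]

theorem interp_at₄ (C : Tm S (n + 1)) (a : Tm S (n + 4)) :
    (C.at₄ a).interp ι = (C.interp ι).at₄ (a.interp ι) := by
  simp only [at₄, interp_inst, interp_wkU]

theorem interp_arrow (A B : Tm S n) :
    (arrow A B).interp ι = arrow (A.interp ι) (B.interp ι) := by
  simp only [arrow, interp, interp_wk]

theorem interp_prod (A B : Tm S n) : (prod A B).interp ι = prod (A.interp ι) (B.interp ι) := by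
  simp only [prod, interp, interp_wk]

theorem interp_transport (C : Tm S (n + 1)) (b p t : Tm S n) :
    (transport C b p t).interp ι =
      transport (C.interp ι) (b.interp ι) (p.interp ι) (t.interp ι) := by
  simp only [transport, interp, interp_wk]

theorem interp_concat (A a c p q : Tm S n) :
    (concat A a c p q).interp ι =
      concat (A.interp ι) (a.interp ι) (c.interp ι) (p.interp ι) (q.interp ι) := by
  simp only [concat, interp, interp_wk]

theorem interp_ap (B : Tm S n) (f : Tm S (n + 1)) (a b p : Tm S n) :
    (ap B f a b p).interp ι =
      ap (B.interp ι) (f.interp ι) (a.interp ι) (b.interp ι) (p.interp ι) := by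
  simp only [ap, interp, interp_wk, interp_inst]

theorem interp_apd (C f : Tm S (n + 1)) (a b p : Tm S n) :
    (apd C f a b p).interp ι =
      apd (C.interp ι) (f.interp ι) (a.interp ι) (b.interp ι) (p.interp ι) := by
  simp only [apd, interp, interp_wk, interp_wkU, interp_inst, interp_transport]

theorem interp_isEquiv (A B f : Tm S n) :
    (isEquiv A B f).interp ι = isEquiv (A.interp ι) (B.interp ι) (f.interp ι) := by
  simp only [isEquiv, interp, interp_wk, interp_prod, interp_arrow]

theorem interp_equiv (A B : Tm S n) :
    (equiv A B).interp ι = equiv (A.interp ι) (B.interp ι) := by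
  simp only [equiv, interp, interp_wk, interp_arrow, interp_isEquiv]

theorem interp_idEquiv (A : Tm S n) : (idEquiv A).interp ι = idEquiv (A.interp ι) := by
  simp only [idEquiv, interp]

theorem interp_idToEquiv (i : ℕ) (A B : Tm S n) :
    (idToEquiv i A B).interp ι = idToEquiv i (A.interp ι) (B.interp ι) := by
  simp only [idToEquiv, interp, interp_wk, interp_equiv, interp_idEquiv]

theorem interp_homotopy (A : Tm S n) (B : Tm S (n + 1)) (f g : Tm S n) :
    (homotopy A B f g).interp ι =
      homotopy (A.interp ι) (B.interp ι) (f.interp ι) (g.interp ι) := by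
  simp only [homotopy, interp, interp_wk]

theorem interp_happly (A : Tm S n) (B : Tm S (n + 1)) (f g : Tm S n) :
    (happly A B f g).interp ι =
      happly (A.interp ι) (B.interp ι) (f.interp ι) (g.interp ι) := by
  simp only [happly, interp, interp_wk, interp_wkU, interp_homotopy]

end Tm

theorem Ctx.interp_get {n : ℕ} (Γ : Ctx S n) (k : Fin n) :
    (Γ.get k).interp ι = (Γ.interp ι).get k := by
  induction Γ with
  | nil => exact k.elim0
  | snoc Γ A ih =>
    cases k using Fin.cases with
    | zero => exact Tm.interp_wk ι A
    | succ k => exact (Tm.interp_wk ι _).trans (congrArg Tm.wk (ih k))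

open Tm in
/-- A translation preserves derivability if it sends the rules specific to the source theory to
admissible rules of the target theory. -/
theorem Der.interp {X X' : Type*} {R : List (X × Judg S) → X × Judg S → Prop}
    {R' : List (X' × Judg S') → X' × Judg S' → Prop} (g : X → X')
    (hR : ∀ ps a J, R ps (a, J) → (∀ p ∈ ps, Der R' (g p.1) (p.2.interp ι)) →
      Der R' (g a) (J.interp ι)) {a : X} {J : Judg S} (h : Der R a J) :
    Der R' (g a) (J.interp ι) := by
  induction h
  case step h _ ih => exact hR _ _ _ h ih
  -- With the interpretation pushed down to the metavariables of a rule, each remaining case is the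
  -- same core rule over the target symbols.
  all_goals simp only [Judg.interp, Ctx.interp, Tm.interp, interp_wk, interp_wkU, interp_inst,
    interp_inst₂, interp_inst₃, interp_at₁, interp_at₂, interp_at₃, interp_at₄, interp_arrow,
    interp_transport, interp_apd, interp_isEquiv, interp_equiv, interp_idToEquiv,
    interp_homotopy, interp_happly] at *
  case ctxNil => exact .ctxNil
  case ctxSnoc h1 => exact .ctxSnoc h1
  case var k _ h1 => exact Ctx.interp_get ι _ k ▸ .var k h1
  case weak => apply Der.weak <;> assumption
  case weakEq => apply Der.weakEq <;> assumption
  case subst => apply Der.subst <;> assumption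
  case substEq => apply Der.substEq <;> assumption
  case substCong => apply Der.substCong <;> assumption
  case eqRefl h1 => exact .eqRefl h1
  case eqSymm h1 => exact .eqSymm h1
  case eqTrans => apply Der.eqTrans <;> assumption
  case conv => apply Der.conv <;> assumption
  case convEq => apply Der.convEq <;> assumption
  case tyOfU h1 => exact .tyOfU h1
  case univ h1 => exact .univ h1
  case cumul h1 => exact .cumul h1
  case cumulEq h1 => exact .cumulEq h1
  case piForm => apply Der.piForm <;> assumption
  case piCong => apply Der.piCong <;> assumption
  case lam => apply Der.lam <;> assumption
  case lamCong => apply Der.lamCong <;> assumption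
  case app => apply Der.app <;> assumption
  case piBeta => apply Der.piBeta <;> assumption
  case piEta h1 => exact .piEta h1
  case sigmaForm => apply Der.sigmaForm <;> assumption
  case sigmaCong => apply Der.sigmaCong <;> assumption
  case pair => apply Der.pair <;> assumption
  case fst h1 => exact .fst h1
  case snd h1 => exact .snd h1
  case fstBeta => apply Der.fstBeta <;> assumption
  case sndBeta => apply Der.sndBeta <;> assumption
  case sigmaEta h1 => exact .sigmaEta h1
  case emptyForm h1 => exact .emptyForm h1
  case emptyInd => apply Der.emptyInd <;> assumption
  case emptyIndCong => apply Der.emptyIndCong <;> assumption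
  case unitForm h1 => exact .unitForm h1
  case star h1 => exact .star h1
  case unitEta h1 => exact .unitEta h1
  case sumForm => apply Der.sumForm <;> assumption
  case inl => apply Der.inl <;> assumption
  case inr => apply Der.inr <;> assumption
  case sumInd => apply Der.sumInd <;> assumption
  case sumIndCong => apply Der.sumIndCong <;> assumption
  case sumBetaL => apply Der.sumBetaL <;> assumption
  case sumBetaR => apply Der.sumBetaR <;> assumption
  case natForm h1 => exact .natForm h1
  case zero h1 => exact .zero h1
  case succ h1 => exact .succ h1
  case natInd => apply Der.natInd <;> assumption
  case natIndCong => apply Der.natIndCong <;> assumption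
  case natBetaZ => apply Der.natBetaZ <;> assumption
  case natBetaS => apply Der.natBetaS <;> assumption
  case listForm h1 => exact .listForm h1
  case nil h1 => exact .nil h1
  case cons => apply Der.cons <;> assumption
  case listInd => apply Der.listInd <;> assumption
  case listIndCong => apply Der.listIndCong <;> assumption
  case listBetaN => apply Der.listBetaN <;> assumption
  case listBetaC => apply Der.listBetaC <;> assumption
  case idForm => apply Der.idForm <;> assumption
  case refl h1 => exact .refl h1
  -- The conclusion of path induction does not determine the base point `s` and its type `A`, so a
  -- search among the assumptions could fix them wrongly; the premises are given by name. Here `h4`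
  -- and `h5` are those on `C` and `c`.
  case J h1 h2 h3 h4 h5 => exact .J h1 h4 h5 h2 h3
  case JCong h1 h2 h3 h4 h5 => exact .JCong h1 h4 h5 h2 h3
  case JBeta => apply Der.JBeta <;> assumption
  case funext => apply Der.funext <;> assumption
  case funextCong => apply Der.funextCong <;> assumption
  case ua => apply Der.ua <;> assumption
  case circleForm h1 => exact .circleForm h1
  case base h1 => exact .base h1
  case loop h1 => exact .loop h1
  case circleInd => apply Der.circleInd <;> assumption
  case circleIndCong => apply Der.circleIndCong <;> assumption
  case circleBeta => apply Der.circleBeta <;> assumption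
  case circleLoop => apply Der.circleLoop <;> assumption
  case circleLoopCong => apply Der.circleLoopCong <;> assumption
  case pushForm => apply Der.pushForm <;> assumption
  case pinl => apply Der.pinl <;> assumption
  case pinr => apply Der.pinr <;> assumption
  case pglue => apply Der.pglue <;> assumption
  case pushInd => apply Der.pushInd <;> assumption
  case pushIndCong => apply Der.pushIndCong <;> assumption
  case pushBetaL => apply Der.pushBetaL <;> assumption
  case pushBetaR => apply Der.pushBetaR <;> assumption
  case pushGlue => apply Der.pushGlue <;> assumption
  case pushGlueCong => apply Der.pushGlueCong <;> assumption
  case truncForm h1 => exact .truncForm h1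
  case tin => apply Der.tin <;> assumption
  case tpath => apply Der.tpath <;> assumption
  case truncInd => apply Der.truncInd <;> assumption
  case truncIndCong => apply Der.truncIndCong <;> assumption
  case truncBeta => apply Der.truncBeta <;> assumption

end Interpretation

/-! ## Derivations over the unit type -/

/-- The context of a judgement is well formed. -/
def Judg.CtxValid {S : Ops.{u}} {X : Type v} (R : List (X × Judg S) → X × Judg S → Prop)
    (a : X) : Judg S → Prop
  | .ctx Γ => Der R a (.ctx Γ)
  | .ty Γ _ => Der R a (.ctx Γ)
  | .tm Γ _ _ => Der R a (.ctx Γ)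
  | .eq Γ _ _ _ => Der R a (.ctx Γ)

/-- Apart from context formation and weakening, every core rule has a premise over the context of
its conclusion, which yields the claim by induction. Weakening extends a context by a type that is
among its premises. -/
theorem Der.ctxValid {S : Ops.{u}} {X : Type v} {R : List (X × Judg S) → X × Judg S → Prop}
    (hR : ∀ ps a J, R ps (a, J) → (∀ p ∈ ps, p.2.CtxValid R p.1) → J.CtxValid R a)
    {a : X} {J : Judg S} (h : Der R a J) : J.CtxValid R a := by
  induction h
  case step h _ ih => exact hR _ _ _ h ih
  case ctxNil => exact .ctxNil
  case ctxSnoc h _ => exact .ctxSnoc h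
  case weak h _ _ _ => exact .ctxSnoc h
  case weakEq h _ _ _ => exact .ctxSnoc h
  all_goals assumption

namespace HoTT

local notation "⊢" J:max => Der (X := Unit) (fun _ _ => False) () J

open Tm Judg

variable {n i : ℕ} {Γ : Ctx coreOps n} {A B C a b c p q t x y : Tm coreOps n}

/-! ### Judgemental collapse of families over the unit type. -/

theorem ctx_of_tm (h : ⊢ (tm Γ t A)) : ⊢ (ctx Γ) :=
  h.ctxValid fun _ _ _ h => h.elim

/-- Eta identifies both elements with `star`. A merely contractible type would give only a path
here, and the judgemental laws of transport would be lost. -/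
theorem eq_of_unit (hx : ⊢ (tm Γ x unit)) (hy : ⊢ (tm Γ y unit)) : ⊢ (eq Γ x y unit) :=
  .eqTrans (.unitEta hx) (.eqSymm (.unitEta hy))

theorem inst_eq {P : Tm coreOps (n + 1)} (hP : ⊢ (tm (Γ.snoc unit) P (U i)))
    (hx : ⊢ (tm Γ x unit)) (hy : ⊢ (tm Γ y unit)) : ⊢ (eq Γ (P.inst x) (P.inst y) (U i)) :=
  .substCong (B := U i) (eq_of_unit hx hy) hP

/-- Turns a family given as a function into an open type, the form to which congruence of
substitution applies. -/
theorem app_var_mem (hC : ⊢ (tm Γ C (arrow unit (U i)))) :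
    ⊢ (tm (Γ.snoc unit) (app C.wk (var 0)) (U i)) :=
  have hu := Der.unitForm (ctx_of_tm hC)
  .app (A := unit) (B := U i) (.weak hu hC) (.var 0 (.ctxSnoc hu))

theorem app_eq (hC : ⊢ (tm Γ C (arrow unit (U i)))) (hx : ⊢ (tm Γ x unit))
    (hy : ⊢ (tm Γ y unit)) : ⊢ (eq Γ (app C x) (app C y) (U i)) := by
  have h := inst_eq (app_var_mem hC) hx hy
  have e (z : Tm coreOps n) : (app C.wk (var 0)).inst z = app C z :=
    congrArg (app · z) (wk_inst C z)
  rwa [e, e] at h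

/-- The typing of collapsed transport: the term stays the same and only its type moves to another
fibre. -/
theorem app_conv (hC : ⊢ (tm Γ C (arrow unit (U i)))) (hx : ⊢ (tm Γ x unit))
    (hy : ⊢ (tm Γ y unit)) (ht : ⊢ (tm Γ t (app C x))) : ⊢ (tm Γ t (app C y)) :=
  .conv ht (app_eq hC hx hy)

/-- The carry type after the base has been collapsed to the unit type. -/
def unitCarry (a : Tm coreOps n) : Tm coreOps n := sigma unit (id unit star a.wk)

theorem unitCarry_fibre (ha : ⊢ (tm Γ a unit)) :
    ⊢ (tm (Γ.snoc unit) (id unit star a.wk) (U 0)) :=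
  have hu := Der.unitForm (ctx_of_tm ha)
  have hc := Der.ctxSnoc hu
  .idForm (.unitForm hc) (.star hc) (.weak hu ha)

theorem id_wk_inst (a b : Tm coreOps n) : (id unit star a.wk).inst b = id unit star a :=
  congrArg (id unit star) (wk_inst a b)

theorem unitCarry_fst (h : ⊢ (tm Γ c (unitCarry a))) : ⊢ (tm Γ (fst c) unit) := .fst h

theorem unitCarry_snd (h : ⊢ (tm Γ c (unitCarry a))) : ⊢ (tm Γ (snd c) (id unit star a)) :=
  id_wk_inst a (fst c) ▸ Der.snd h

theorem unitCarry_pair (ha : ⊢ (tm Γ a unit)) (hb : ⊢ (tm Γ b unit))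
    (hp : ⊢ (tm Γ p (id unit star a))) : ⊢ (tm Γ (pair b p) (unitCarry a)) :=
  .pair (unitCarry_fibre ha) hb ((id_wk_inst a b).symm ▸ hp)

/-! ### Paths in the unit type: collapsed restriction and concatenation. -/

theorem snoc_path_ctx (hx : ⊢ (tm Γ x unit)) :
    ⊢ (ctx ((Γ.snoc unit).snoc (id unit x.wk (var 0)))) :=
  have hu := Der.unitForm (ctx_of_tm hx)
  have hc := Der.ctxSnoc hu
  .ctxSnoc (.idForm (.unitForm hc) (.weak hu hx) (.var 0 hc))

/-- A restriction map collapses to the constant map at `star`, so the motive of its action on paths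
is the constant family `id unit star star`. -/
theorem ap_star_mem (hx : ⊢ (tm Γ x unit)) (hy : ⊢ (tm Γ y unit))
    (hp : ⊢ (tm Γ p (id unit x y))) :
    ⊢ (tm Γ (ap unit star x y p) (id unit star star)) :=
  have hc := snoc_path_ctx hx
  have hg := ctx_of_tm hx
  .J (C := id unit star star) hx (.idForm (.unitForm hc) (.star hc) (.star hc))
    (.refl (.star hg)) hy hp

theorem ap_star_refl (hx : ⊢ (tm Γ x unit)) :
    ⊢ (eq Γ (ap unit star x x (refl x)) (refl star) (id unit star star)) :=
  have hc := snoc_path_ctx hx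
  have hg := ctx_of_tm hx
  .JBeta (C := id unit star star) hx (.idForm (.unitForm hc) (.star hc) (.star hc))
    (.refl (.star hg))

/-- This is the motive of `concat` for paths that start at `star`, as all paths `r(a') = a` of
carries do after the collapse; `var 1` is the moving endpoint. -/
theorem concat_family (hx : ⊢ (tm Γ x unit)) :
    ⊢ (tm ((Γ.snoc unit).snoc (id unit x.wk (var 0))) (id unit star (var 1)) (U 0)) :=
  have hc := snoc_path_ctx hx
  .idForm (.unitForm hc) (.star hc) (.var 1 hc)

theorem concat_mem (hx : ⊢ (tm Γ x unit)) (hy : ⊢ (tm Γ y unit))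
    (hp : ⊢ (tm Γ p (id unit star x))) (hq : ⊢ (tm Γ q (id unit x y))) :
    ⊢ (tm Γ (concat unit star y p q) (id unit star y)) :=
  .J (C := id unit star (var 1)) hx (concat_family hx) hp hy hq

theorem concat_refl (hx : ⊢ (tm Γ x unit)) (hp : ⊢ (tm Γ p (id unit star x))) :
    ⊢ (eq Γ (concat unit star x p (refl x)) p (id unit star x)) :=
  .JBeta (C := id unit star (var 1)) hx (concat_family hx) hp

/-- The collapse of a triangle. -/
theorem refl_refl_mem (h : ⊢ (ctx Γ)) :
    ⊢ (tm Γ (refl (refl star))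
      (id (id unit star star) (concat unit star star (refl star) (refl star)) (refl star))) :=
  have path {m : ℕ} {Δ : Ctx coreOps m} (h : ⊢ (ctx Δ)) : ⊢ (tm Δ (id unit star star) (U 0)) :=
    .idForm (.unitForm h) (.star h) (.star h)
  have hs := Der.refl (.star h)
  have hc := Der.ctxSnoc (path h)
  -- The concatenation of two copies of `refl star` computes to `refl star`. The left endpoint of
  -- the identity type is abstracted to `var 0`, so that congruence of substitution carries this
  -- equality into the type.
  .conv (.refl hs) (.substCong (t := id (id unit star star) (var 0) (refl star)) (B := U 0)
    (.eqSymm (concat_refl (.star h) hs)) (.idForm (path hc) (.var 0 hc) (.refl (.star hc))))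

/-- The family `C` reindexed along the collapse of a restriction map. -/
theorem reindex_beta (hC : ⊢ (tm Γ C (arrow unit (U i)))) (hx : ⊢ (tm Γ x unit)) :
    ⊢ (eq Γ (app (lam unit (app C.wk star)) x) (app C star) (U i)) := by
  have hg := ctx_of_tm hC
  have hu := Der.unitForm hg
  have h := Der.piBeta (B := U i) hu
    (.app (A := unit) (B := U i) (.weak hu hC) (.star (.ctxSnoc hu))) hx
  have e : (app C.wk star).inst x = app C star := congrArg (app · star) (wk_inst C x)
  rwa [e] at h

/-- The decision type of a verdict in `unit + unit`. -/
def verdict (p : Tm coreOps n) : Tm coreOps n := sumInd (U 0) unit empty p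

/-! ### Verdicts of the policy as elements of `unit + unit`. -/

theorem bool_mem (h : ⊢ (ctx Γ)) : ⊢ (tm Γ (sum unit unit) (U 0)) :=
  .sumForm (.unitForm h) (.unitForm h)

theorem ctx_snoc_unit (h : ⊢ (ctx Γ)) : ⊢ (ctx (Γ.snoc unit)) := .ctxSnoc (.unitForm h)

theorem ctx_snoc_bool (h : ⊢ (ctx Γ)) : ⊢ (ctx (Γ.snoc (sum unit unit))) :=
  .ctxSnoc (bool_mem h)

/-- Large elimination: the motive is the constant family `U 0`, itself a type in `U 1`. -/
theorem verdict_mem (hp : ⊢ (tm Γ p (sum unit unit))) : ⊢ (tm Γ (verdict p) (U 0)) :=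
  have hg := ctx_of_tm hp
  .sumInd (C := U 0) (.univ (ctx_snoc_bool hg)) (.unitForm (ctx_snoc_unit hg))
    (.emptyForm (ctx_snoc_unit hg)) hp

theorem verdict_inl (h : ⊢ (ctx Γ)) : ⊢ (eq Γ (verdict (inl star)) unit (U 0)) :=
  .sumBetaL (C := U 0) (c := unit) (d := empty) (t := star) (.univ (ctx_snoc_bool h))
    (.unitForm (ctx_snoc_unit h)) (.emptyForm (ctx_snoc_unit h)) (.star h)

theorem verdict_inr (h : ⊢ (ctx Γ)) : ⊢ (eq Γ (verdict (inr star)) empty (U 0)) :=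
  .sumBetaR (C := U 0) (c := unit) (d := empty) (t := star) (.univ (ctx_snoc_bool h))
    (.unitForm (ctx_snoc_unit h)) (.emptyForm (ctx_snoc_unit h)) (.star h)

theorem inl_star_mem (h : ⊢ (ctx Γ)) : ⊢ (tm Γ (inl star) (sum unit unit)) :=
  .inl (.unitForm h) (.unitForm h) (.star h)

theorem inr_star_mem (h : ⊢ (ctx Γ)) : ⊢ (tm Γ (inr star) (sum unit unit)) :=
  .inr (.unitForm h) (.unitForm h) (.star h)

theorem star_mem_verdict (h : ⊢ (ctx Γ)) : ⊢ (tm Γ star (verdict (inl star))) :=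
  .conv (.star h) (.eqSymm (verdict_inl h))

/-- The verdict type at `inr star` computes to `empty`, so the identity function refutes it. -/
theorem refute_verdict (h : ⊢ (ctx Γ)) :
    ⊢ (tm Γ (lam (verdict (inr star)) (var 0)) (arrow (verdict (inr star)) empty)) :=
  have hv := verdict_mem (inr_star_mem h)
  have hc := Der.ctxSnoc hv
  .lam hv (.conv (.var 0 hc) (verdict_inr hc))

/-- The rupture type after the base has been collapsed to the unit type and attempts to their
verdicts. -/
theorem unitRupture_mem (h : ⊢ (ctx Γ)) :
    ⊢ (tm Γ (sigma unit (sigma (sum unit unit)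
      (prod (arrow (verdict (var 0)) empty) unit))) (U 0)) :=
  have h1 := ctx_snoc_unit h
  have h2 := ctx_snoc_bool h1
  have hv := verdict_mem (.var (Γ := (Γ.snoc unit).snoc (sum unit unit)) 0 h2)
  have ha := Der.piForm (B := empty) hv (.emptyForm (.ctxSnoc hv))
  .sigmaForm (.unitForm h) (.sigmaForm (bool_mem h1)
    (.sigmaForm (B := unit) ha (.unitForm (.ctxSnoc ha))))

end HoTT

/-! ## Collapsing the evolving text -/

section Collapse

variable {T : Type u} [PartialOrder T] {E : EvolvingText T}

open Tm in
/-- The interpretation of the symbols of DHoTT in HoTT that collapses every slice to the unit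
type and remembers of an attempt only whether the policy admits it. -/
def DynOp.collapse : (f : DynOp E) → Tm coreOps f.ar
  | .ET _ => unit
  | .res _ => star
  | .pt _ _ => star
  | .edge _ _ => refl star
  | .tri _ _ => refl (refl star)
  -- The arguments are family, path and term, so index `2` selects the term.
  | .tr _ => var (n := 3) 2
  | .att _ => sum unit unit
  | .chain τ c => if E.adm τ c.chain then inl star else inr star
  | .adm _ => HoTT.verdict (var (n := 1) 0)
  -- The symbols `admYes` and `admNo` exist for every chain, but the rules type each only under the
  -- matching decision of the policy, so these values need not depend on the chain.
  | .admYes _ _ => star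
  | .admNo _ _ => lam (HoTT.verdict (inr star)) (var 0)
  | .horn _ => unit
  | .tag _ _ _ => star
  | .rupSum _ => unit
  | .rupIn _ => star
  | .carSum _ => unit
  | .carIn _ => star
  | .pal _ _ => unit
  | .item _ _ _ _ => star

/-- The interpretation of DHoTT in HoTT given by `DynOp.collapse`. -/
def collapse (E : EvolvingText T) : Interp (dynOps E) coreOps := DynOp.collapse

/-- The decision of the policy is made outside the syntax; either outcome is a closed expression,
unaffected by substitution. -/
theorem collapse_chain {n : ℕ} {τ : T} {x y : E.Simplex 0 τ} (c : E.Attempt τ x y) :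
    (tmChain τ c : DTm E n).interp (collapse E) =
      if E.adm τ c.chain then .inl .star else .inr .star := by
  change (if E.adm τ c.chain then Tm.inl Tm.star else Tm.inr Tm.star : Tm coreOps 0).subst _ = _
  split <;> rfl

/-- All symbols in a carry type compute under the collapse; only the weakening of `a` needs a lemma.
-/
theorem collapse_carry {n : ℕ} {τ τ' : T} (h : τ ≤ τ') (a : DTm E n) :
    (carry h a).interp (collapse E) =
      HoTT.unitCarry (a.interp (collapse E)) :=
  congrArg (fun b => Tm.sigma .unit (.id .unit .star b)) (Tm.interp_wk _ a)

theorem collapse_upFam {n : ℕ} {τ τ' : T} (h : τ ≤ τ') (C : DTm E n) :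
    (upFam h C).interp (collapse E) =
      .lam .unit (.app (C.interp (collapse E)).wk .star) :=
  congrArg (fun b => Tm.lam .unit (.app b .star)) (Tm.interp_wk _ C)

open Tm HoTT in
/-- The collapse of every rule of DHoTT is admissible in HoTT. -/
theorem DynRule.collapse {ps : List (T × Judg (dynOps E))} {q : T × Judg (dynOps E)}
    (hq : DynRule E ps q)
    (hps : ∀ p ∈ ps, Der (X := Unit) (fun _ _ => False) ()
      (p.2.interp (collapse E))) :
    Der (X := Unit) (fun _ _ => False) () (q.2.interp (collapse E)) := by
  cases hq <;> simp only [List.forall_mem_cons, List.not_mem_nil, false_implies, implies_true,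
    and_true, Judg.interp, interp_arrow, interp_inst, collapse_carry] at hps ⊢
  case etForm => exact .unitForm hps
  case res => exact .star (ctx_of_tm hps)
  case resId => exact .eqSymm (.unitEta hps)
  case resComp => exact .eqRefl (.star (ctx_of_tm hps))
  case pt => exact .star hps
  case resPt => exact .eqRefl (.star hps)
  case edge => exact .refl (.star hps)
  case edgeDegen => exact .eqRefl (.refl (.star hps))
  case resEdge =>
    rw [interp_ap]
    exact ap_star_refl (.star hps)
  case tri => exact refl_refl_mem hps
  case transport =>
    obtain ⟨hx, hy, hp, hC, ht⟩ := hps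
    exact app_conv hC hx hy ht
  case transportRefl => exact .eqRefl hps.2.2
  case transportConst => exact .eqRefl hps.2.2.2.2
  case transportConcat =>
    obtain ⟨hx, hy, hz, hp, hq, hC, ht⟩ := hps
    -- Both sides collapse to the collapsed `t`; what has to be shown is that it lies in the fibre
    -- over `z`.
    exact .eqRefl (app_conv hC hx hz ht)
  case carryForm => exact .sigmaForm (.unitForm (ctx_of_tm hps)) (unitCarry_fibre hps)
  case carryIntro => exact unitCarry_pair hps.1 hps.2.1 hps.2.2
  case carryUse =>
    obtain ⟨ha, hC, ht, hκ⟩ := hps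
    rw [interp, collapse_upFam]
    -- The fibre over `a` equals the fibre over `star`, and the reindexed family beta-reduces to
    -- that fibre at any point. The change of anchor has disappeared.
    exact .conv (app_conv hC ha (.star (ctx_of_tm ha)) ht)
      (.eqSymm (reindex_beta hC (unitCarry_fst hκ)))
  case carryComp =>
    obtain ⟨ha, h1, h2⟩ := hps
    have hs := Der.star (ctx_of_tm ha)
    rw [DynHoTT.carryComp, interp, interp_concat, interp_ap]
    -- The restricted path of the second carry becomes a loop at `star`, and the path of the first
    -- leads from `star` to `a`; the concatenation goes through `star`.
    exact unitCarry_pair ha (unitCarry_fst h2) (concat_mem hs ha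
      (ap_star_mem hs (unitCarry_fst h1) (unitCarry_snd h2)) (unitCarry_snd h1))
  case carryCompUse =>
    obtain ⟨ha, hC, ht, hκ⟩ := hps
    -- Direct and successive transport both collapse to the collapsed `t`, and the restricted echo
    -- collapses to `star`.
    exact .eqRefl (app_conv hC ha (.star (ctx_of_tm ha)) ht)
  case depCarry =>
    obtain ⟨ha, hP, ht, hκ⟩ := hps
    have ht' := Der.subst ha ht
    rw [← interp_inst] at ht'
    -- The value of the section at `a` has type `P[a]`, which equals `P[star]` by eta.
    exact .conv ht' (inst_eq hP ha (.star (ctx_of_tm ha)))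
  case attForm => exact bool_mem (ctx_of_tm hps.1)
  case chain =>
    rw [collapse_chain]
    split
    exacts [inl_star_mem hps, inr_star_mem hps]
  case admForm => exact verdict_mem hps
  case admYes c hc _ _ =>
    -- Exposes the collapsed chain inside the verdict type, so that the policy's decision can be
    -- rewritten there.
    change Der _ _ (.tm _ star (verdict ((tmChain _ c).interp (DynHoTT.collapse E))))
    rw [collapse_chain, if_pos hc]
    exact star_mem_verdict hps
  case admNo c hc _ _ =>
    change Der _ _ (.tm _ (lam (verdict (inr star)) (var 0))
      (arrow (verdict ((tmChain _ c).interp (DynHoTT.collapse E))) empty))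
    rw [collapse_chain, if_neg (by simp [hc])]
    exact refute_verdict hps
  case hornForm => exact .unitForm (ctx_of_tm hps)
  case tag => exact .star hps
  case ruptureForm => exact unitRupture_mem (ctx_of_tm hps)
  case rupSumForm => exact .unitForm (ctx_of_tm hps)
  case rupIn => exact .star (ctx_of_tm hps.1)
  case carSumForm => exact .unitForm (ctx_of_tm hps)
  case carIn => exact .star (ctx_of_tm hps.1)
  -- Both kinds of entries collapse to `unit`, so the entry type is again `unit + unit`.
  case ledgerForm => exact .listForm (bool_mem (ctx_of_tm hps))
  -- The context comes from the separate first premise, which is present even when the arity is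
  -- zero.
  case palForm => exact .unitForm hps.1
  case item => exact .star hps

end Collapse

/-! ## The inclusion of HoTT -/

section Inclusion

/-- The interpretation of the empty family of operation symbols of HoTT. -/
def coreInterp (S : Ops.{u}) : Interp coreOps S := fun f => Empty.elim f

/-- Presents the inclusion as an interpretation, so that `Der.interp` applies to it as well. -/
theorem Tm.embed_eq_interp {S : Ops.{u}} {n : ℕ} (t : Tm coreOps n) :
    (t.embed : Tm S n) = t.interp (coreInterp S) := by
  induction t with
  | op f _ => exact Empty.elim f
  | _ => simp_all only [embed, interp]

theorem Ctx.embed_eq_interp {S : Ops.{u}} {n : ℕ} (Γ : Ctx coreOps n) :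
    (Γ.embed : Ctx S n) = Γ.interp (coreInterp S) := by
  induction Γ with
  | nil => rfl
  | snoc Γ A ih => rw [embed, interp, ih, Tm.embed_eq_interp]

theorem Judg.embed_eq_interp {S : Ops.{u}} (J : HoTTJudg) :
    (J.embed : Judg S) = J.interp (coreInterp S) := by
  cases J <;> simp only [embed, interp, Ctx.embed_eq_interp, Tm.embed_eq_interp]

/-- An embedded expression contains no operation symbols, so `ι` is never consulted. The retraction
is a syntactic equality, not only one up to derivable equality. -/
theorem Tm.interp_embed {S : Ops.{u}} (ι : Interp S coreOps) {n : ℕ} (t : Tm coreOps n) :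
    (t.embed : Tm S n).interp ι = t := by
  induction t with
  | op f _ => exact Empty.elim f
  | _ => simp_all only [embed, interp]

theorem Ctx.interp_embed {S : Ops.{u}} (ι : Interp S coreOps) {n : ℕ} (Γ : Ctx coreOps n) :
    (Γ.embed : Ctx S n).interp ι = Γ := by
  induction Γ with
  | nil => rfl
  | snoc Γ A ih => rw [embed, interp, ih, Tm.interp_embed]

theorem Judg.interp_embed {S : Ops.{u}} (ι : Interp S coreOps) (J : HoTTJudg) :
    (J.embed : Judg S).interp ι = J := by
  cases J <;> simp only [embed, interp, Ctx.interp_embed, Tm.interp_embed]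

end Inclusion

end DynHoTT

/-! ### Conservativity. -/

theorem mainTheorem1 {T : Type u} [PartialOrder T] (E : DynHoTT.EvolvingText T) (τ : T)
    (J : DynHoTT.HoTTJudg) (hJ : J.IsClosed) :
    DynHoTT.HoTTDerivable J ↔ DynHoTT.DHoTTDerivable E τ J.embed := by
  constructor
  · intro h
    rw [DynHoTT.Judg.embed_eq_interp]
    -- The unique anchor of HoTT goes to `τ`; there are no specific rules to translate.
    exact h.interp _ (fun _ => τ) fun _ _ _ h => h.elim
  · intro h
    -- All times go to one anchor, so rules whose premises sit at several times become ordinary HoTT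
    -- inferences.
    have h' := h.interp (DynHoTT.collapse E) (fun _ => ())
      fun _ _ _ hq hps => hq.collapse hps
    rwa [DynHoTT.Judg.interp_embed] at h'
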